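/- **Setting.** Let $\mathsf G=(\mathsf V,\mathsf E)$ be a finite directed graph without loops, let $k_{\mathsf e}\ge 1$ be integers and $\ell_{\mathsf e}>0$ real numbers ($\mathsf e\in\mathsf E$). Each edge $\mathsf e$ is identified with $[0,\ell_{\mathsf e}]$, where $0$ is its initial and $\ell_{\mathsf e}$ its terminal endpoint; $u_{\mathsf e}(\mathsf v)$ denotes the value of $u_{\mathsf e}$ at the endpoint $\mathsf v$ of $\mathsf e$. Let $\iota_{\mathsf v\mathsf e}=1$ if $\mathsf v$ is the terminal endpoint of $\mathsf e$, $-1$ if it is the initial one, and $0$ otherwise; let $\mathsf E_{\mathsf v}$ be the set of edges incident in $\mathsf v$, $k=\sum_{\mathsf e\in\mathsf E}k_{\mathsf e}$ and $k_{\mathsf v}=\sum_{\mathsf e\in\mathsf E_{\mathsf v}}k_{\mathsf e}$. For each $\mathsf e$ let $M_{\mathsf e},N_{\mathsf e},Q_{\mathsf e}:[0,\ell_{\mathsf e}]\to M_{k_{\mathsf e}}(\mathbb C)$ be such that $M_{\mathsf e}$ is Lipschitz continuous with $M_{\mathsf e}(x)$ invertible for all $x$, $N_{\mathsf e}$ is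 of class $L^\infty$, and $Q_{\mathsf e}$ is Lipschitz continuous and uniformly positive definite with $Q_{\mathsf e}(x)$ and $Q_{\mathsf e}(x)M_{\mathsf e}(x)$ Hermitian for all $x$. For each $\mathsf v\in\mathsf V$ let $Y^{(d)}_{\mathsf v}\subset Y_{\mathsf v}$ be subspaces of $\mathbb C^{k_{\mathsf v}}$, $B_{\mathsf v}:Y_{\mathsf v}\to Y_{\mathsf v}^{(d)}$ and $C_{\mathsf v}:Y_{\mathsf v}^{(d)}\to Y_{\mathsf v}^{(d)}$ linear operators, and $Q_{\mathsf v}$ a Hermitian positive definite operator on $Y_{\mathsf v}^{(d)}$. Let $B_{\mathsf v}^*:Y_{\mathsf v}^{(d)}\to Y_{\mathsf v}$ be the adjoint of $B_{\mathsf v}$ with respect to the Euclidean inner products, $P_{\mathsf v}^{(d)}$ the orthogonal projector of $\mathbb C^{k_{\mathsf v}}$ onto $Y_{\mathsf v}^{(d)}$, and $T_{\mathsf v}=\operatorname{diag}\bigl(\iota_{\mathsf v\mathsf e}Q_{\mathsf e}(\mathsf v)M_{\mathsf e}(\mathsf v)\bigr)_{\mathsf e\in\mathsf E_{\mathsf v}}$.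 Let $\mathbf L^2(\mathcal G)=\bigoplus_{\mathsf e}L^2(0,\ell_{\mathsf e})^{k_{\mathsf e}}$, $D_{\max}=\bigoplus_{\mathsf e}H^1(0,\ell_{\mathsf e})^{k_{\mathsf e}}$, $Y^{(d)}=\bigoplus_{\mathsf v}Y_{\mathsf v}^{(d)}$, and $\gamma_{\mathsf v}(u)=(u_{\mathsf e}(\mathsf v))_{\mathsf e\in\mathsf E_{\mathsf v}}\in\mathbb C^{k_{\mathsf v}}$ for $u\in D_{\max}$. On the Hilbert space $\mathbf L^2_d(\mathcal G)=\mathbf L^2(\mathcal G)\oplus Y^{(d)}$ consider the operator $$\mathbb A\begin{pmatrix}u\\ \mathsf x\end{pmatrix}=\begin{pmatrix}(M_{\mathsf e}u_{\mathsf e}'+N_{\mathsf e}u_{\mathsf e})_{\mathsf e\in\mathsf E}\\ (B_{\mathsf v}\gamma_{\mathsf v}(u)+C_{\mathsf v}\mathsf x_{\mathsf v})_{\mathsf v\in\mathsf V}\end{pmatrix},$$ $$D(\mathbb A)=\Bigl\{\begin{pmatrix}u\\ \mathsf x\end{pmatrix}\in D_{\max}\oplus Y^{(d)}:\ \gamma_{\mathsf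 v}(u)\in Y_{\mathsf v},\ \mathsf x_{\mathsf v}=P_{\mathsf v}^{(d)}\gamma_{\mathsf v}(u)\ \text{for all }\mathsf v\in\mathsf V\Bigr\}.$$ For $w\in\mathbb C^{k_{\mathsf v}}$ let $\widetilde w\in\mathbb C^k$ be its extension by $0$ to the edges not incident in $\mathsf v$. For each $\mathsf v$ fix bases $(w^{(\mathsf v,i)})_i$ of $Y_{\mathsf v}^\perp$ (orthogonal complement in $\mathbb C^{k_{\mathsf v}}$), $(y^{(\mathsf v,j)})_j$ of $\operatorname{Ran}B_{\mathsf v}$, and $(w_K^{(\mathsf v,l)})_l$ of $\operatorname{Ker}B_{\mathsf v}^*$. **Theorem.** Assume that 1. the family consisting of all $\widetilde{w^{(\mathsf v,i)}}$, all $\widetilde{B_{\mathsf v}^*y^{(\mathsf v,j)}}$ and all $\widetilde{w_K^{(\mathsf v,l)}}$, over all $\mathsf v\in\mathsf V$ and all $i,j,l$ (counted as an indexed family), is a basis of $\mathbb C^k$; 2. for each $\mathsf v\in\mathsf V$ there is $\lambda\ge 0$ such that $Y_{\mathsf v}$ is contained in the nonpositive isotropic cone of the quadratic form associated with $T_{\mathsf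 v}+Q_{\mathsf v}B_{\mathsf v}+B_{\mathsf v}^*Q_{\mathsf v}-\lambda P_{\mathsf v}^{(d)}Q_{\mathsf v}P_{\mathsf v}^{(d)}$, that is, for all $\xi\in Y_{\mathsf v}$, $$\bigl(T_{\mathsf v}\xi+Q_{\mathsf v}B_{\mathsf v}\xi+B_{\mathsf v}^*Q_{\mathsf v}P_{\mathsf v}^{(d)}\xi-\lambda Q_{\mathsf v}P_{\mathsf v}^{(d)}\xi\bigr)\cdot\bar\xi\le 0 .$$ Then $\mathbb A$ generates a strongly continuous semigroup on $\mathbf L_d^2(\mathcal G)$. -/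

import Mathlib

open MeasureTheory Set Filter Topology
open scoped ENNReal NNReal ContDiff

theorem integral_deriv_smul_primitive {F : Type*} [NormedAddCommGroup F] [NormedSpace ℝ F]
    [CompleteSpace F] {ℓ : ℝ} (g : ℝ → F)
    (hg : Integrable g (volume.restrict (Ioo 0 ℓ))) (φ : ℝ → ℝ) (hφ : ContDiff ℝ ∞ φ)
    (hc : HasCompactSupport φ) (hs : tsupport φ ⊆ Ioo 0 ℓ) :
    ∫ x in Ioo 0 ℓ, deriv φ x • ∫ t in Ioc 0 x, g t ∂(volume.restrict (Ioo 0 ℓ))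
      = - ∫ x in Ioo 0 ℓ, φ x • g x := by
  have hd : Continuous (deriv φ) := hφ.continuous_deriv (by norm_num)
  have hzero : φ ℓ = 0 := by
    apply image_eq_zero_of_notMem_tsupport
    intro h
    exact lt_irrefl _ (hs h).2
  have hdi : Integrable (deriv φ) (volume.restrict (Ioo 0 ℓ)) :=
    (hd.integrable_of_hasCompactSupport hc.deriv).restrict
  have h1 : Integrable (fun p : ℝ × ℝ => ({p : ℝ × ℝ | p.2 ∈ Ioc 0 p.1}).indicator
      (fun p => deriv φ p.1 • g p.2) p)
      ((volume.restrict (Ioo 0 ℓ)).prod (volume.restrict (Ioo 0 ℓ))) := by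
    apply (hdi.smul_prod hg).indicator
    exact (measurableSet_lt measurable_const measurable_snd).inter
      (measurableSet_le measurable_snd measurable_fst)
  have h2 := integral_integral_swap (f := fun x t => ({p : ℝ × ℝ | p.2 ∈ Ioc 0 p.1}).indicator
      (fun p => deriv φ p.1 • g p.2) (x, t)) h1
  calc ∫ x in Ioo 0 ℓ, deriv φ x • ∫ t in Ioc 0 x, g t ∂(volume.restrict (Ioo 0 ℓ))
    _ = ∫ x in Ioo 0 ℓ, ∫ t in Ioo 0 ℓ, ({p : ℝ × ℝ | p.2 ∈ Ioc 0 p.1}).indicator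
      (fun p => deriv φ p.1 • g p.2) (x, t) := by
        congr 1; ext x
        rw [← integral_smul, ← integral_indicator measurableSet_Ioc]
        rfl
    _ = _ := h2
    _ = ∫ t in Ioo 0 ℓ, - (φ t • g t) := by
        refine setIntegral_congr_fun measurableSet_Ioo fun t ht => ?_
        have h3 : ∀ x, ({p : ℝ × ℝ | p.2 ∈ Ioc 0 p.1}).indicator
            (fun p => deriv φ p.1 • g p.2) (x, t) = ((Ici t).indicator (deriv φ) x) • g t := by
          intro x
          by_cases hx : t ≤ x
          · simp [indicator, hx, ht.1]
          · simp [indicator, hx]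
        simp_rw [h3]
        rw [integral_smul_const, integral_indicator measurableSet_Ici,
          Measure.restrict_restrict measurableSet_Ici]
        have h4 : Ici t ∩ Ioo 0 ℓ = Ico t ℓ := by
          ext x; simp only [mem_inter_iff, mem_Ici, mem_Ioo, mem_Ico]
          constructor
          · rintro ⟨a, b, c⟩; exact ⟨a, c⟩
          · rintro ⟨a, b⟩; exact ⟨a, ht.1.trans_le a, b⟩
        rw [h4, integral_Ico_eq_integral_Ioc, ← intervalIntegral.integral_of_le ht.2.le,
          intervalIntegral.integral_deriv_eq_sub
            (fun x _ => (hφ.differentiable (by norm_num)).differentiableAt)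
            (hd.intervalIntegrable _ _), hzero]
        simp
    _ = _ := integral_neg _

theorem ae_eq_const_of_integral_deriv_smul {F : Type*} [NormedAddCommGroup F] [NormedSpace ℝ F]
    [CompleteSpace F] {ℓ : ℝ} (hℓ : 0 < ℓ) (w : ℝ → F)
    (hw : Integrable w (volume.restrict (Ioo 0 ℓ)))
    (h : ∀ φ : ℝ → ℝ, ContDiff ℝ ∞ φ → HasCompactSupport φ → tsupport φ ⊆ Ioo 0 ℓ →
      ∫ x in Ioo 0 ℓ, deriv φ x • w x = 0) :
    ∃ c : F, ∀ᵐ x ∂(volume.restrict (Ioo 0 ℓ)), w x = c := by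
  have hbi : ∀ φ : ℝ → ℝ, Continuous φ → HasCompactSupport φ →
      Integrable (fun x => φ x • w x) (volume.restrict (Ioo 0 ℓ)) := by
    intro φ hφ hc
    obtain ⟨C, hC⟩ := hφ.bounded_above_of_compact_support hc
    exact hw.bdd_smul C hφ.aestronglyMeasurable (Eventually.of_forall hC)
  let ψb : ContDiffBump (ℓ / 2) := ⟨ℓ / 8, ℓ / 4, by linarith, by linarith⟩
  let ψ : ℝ → ℝ := ψb.normed volume
  have hψd : ContDiff ℝ ∞ ψ := ψb.contDiff_normed
  have hψc : HasCompactSupport ψ := ψb.hasCompactSupport_normed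
  have hψs : tsupport ψ = Metric.closedBall (ℓ / 2) (ℓ / 4) := ψb.tsupport_normed_eq
  have hψs' : tsupport ψ ⊆ Ioo 0 ℓ := by
    rw [hψs, Real.closedBall_eq_Icc]
    intro x hx
    exact ⟨by linarith [hx.1], by linarith [hx.2]⟩
  have hψi : ∫ x, ψ x = 1 := ψb.integral_normed
  refine ⟨∫ x in Ioo 0 ℓ, ψ x • w x, ?_⟩
  set c : F := ∫ x in Ioo 0 ℓ, ψ x • w x with hcdef
  have key := isOpen_Ioo.ae_eq_zero_of_integral_contDiff_smul_eq_zero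
    (μ := volume.restrict (Ioo 0 ℓ)) (U := Ioo (0 : ℝ) ℓ) (f := fun x => w x - c)
    ((hw.sub (integrable_const c)).locallyIntegrable.locallyIntegrableOn _) ?_
  · filter_upwards [key, ae_restrict_mem measurableSet_Ioo] with x hx hx'
    exact sub_eq_zero.1 (hx hx')
  intro φ hφ hc hs
  set m : ℝ := ∫ x, φ x with hm
  have hφi : Integrable φ := hφ.continuous.integrable_of_hasCompactSupport hc
  have hψint : Integrable ψ := hψd.continuous.integrable_of_hasCompactSupport hψc
  let θ : ℝ → ℝ := fun x => φ x - m * ψ x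
  have hθd : ContDiff ℝ ∞ θ := hφ.sub (contDiff_const.mul hψd)
  have hθc : Continuous θ := hθd.continuous
  have hθ0 : ∫ x, θ x = 0 := by
    simp only [θ]
    rw [integral_sub hφi (hψint.const_mul m), integral_const_mul, hψi, ← hm]
    ring
  have hK : IsCompact (tsupport φ ∪ tsupport ψ) := IsCompact.union hc hψc
  have hKne : (tsupport φ ∪ tsupport ψ).Nonempty := by
    refine ⟨ℓ / 2, Or.inr ?_⟩
    rw [hψs]
    exact Metric.mem_closedBall_self (by linarith)
  have hKs : tsupport φ ∪ tsupport ψ ⊆ Ioo 0 ℓ := union_subset hs hψs'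
  obtain ⟨a, haK, ha⟩ := hK.exists_isLeast hKne
  obtain ⟨b, hbK, hb⟩ := hK.exists_isGreatest hKne
  have hθK : ∀ x, x ∉ tsupport φ ∪ tsupport ψ → θ x = 0 := by
    intro x hx
    simp only [mem_union, not_or] at hx
    simp [θ, image_eq_zero_of_notMem_tsupport hx.1, image_eq_zero_of_notMem_tsupport hx.2]
  have hθab : ∀ x, x ∉ Icc a b → θ x = 0 := fun x hx =>
    hθK x fun h => hx ⟨ha h, hb h⟩
  let η : ℝ → ℝ := fun x => ∫ t in a..x, θ t
  have hηd : ∀ x, HasDerivAt η (θ x) x := fun x =>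
    intervalIntegral.integral_hasDerivAt_right (hθc.intervalIntegrable _ _)
      (hθc.stronglyMeasurableAtFilter _ _) hθc.continuousAt
  have hηderiv : deriv η = θ := funext fun x => (hηd x).deriv
  have hηC : ContDiff ℝ ∞ η := by
    rw [contDiff_infty_iff_deriv]
    exact ⟨fun x => (hηd x).differentiableAt, by rw [hηderiv]; exact hθd⟩
  have hηab : ∀ x, x ∉ Icc a b → η x = 0 := by
    intro x hx
    rcases lt_or_ge x a with hxa | hxa
    · simp only [η]
      rw [intervalIntegral.integral_symm, intervalIntegral.integral_of_le hxa.le,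
        ← integral_Ico_eq_integral_Ioc, setIntegral_eq_zero_of_forall_eq_zero, neg_zero]
      intro t ht
      exact hθab t fun h => absurd h.1 (not_le.2 ht.2)
    · have hxb : b < x := by
        by_contra h
        exact hx ⟨hxa, not_lt.1 h⟩
      simp only [η]
      rw [intervalIntegral.integral_of_le hxa, ← integral_Icc_eq_integral_Ioc,
        setIntegral_eq_integral_of_forall_compl_eq_zero, hθ0]
      intro t ht
      exact hθab t fun h => ht ⟨h.1, h.2.trans hxb.le⟩
  have hηc : HasCompactSupport η := HasCompactSupport.intro isCompact_Icc hηab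
  have hηs : tsupport η ⊆ Ioo 0 ℓ := by
    refine (closure_minimal (fun x hx => ?_) isClosed_Icc : tsupport η ⊆ Icc a b).trans ?_
    · by_contra h
      exact hx (hηab x h)
    · intro x hx
      exact ⟨(hKs haK).1.trans_le hx.1, hx.2.trans_lt (hKs hbK).2⟩
  have h0 := h η hηC hηc hηs
  rw [hηderiv] at h0
  have hm' : ∫ x in Ioo 0 ℓ, φ x = m := by
    apply setIntegral_eq_integral_of_forall_compl_eq_zero
    intro x hx
    exact image_eq_zero_of_notMem_tsupport fun h => hx (hs h)
  simp only [θ, sub_smul, mul_smul] at h0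
  have hsm : Integrable (fun x => m • ψ x • w x) (volume.restrict (Ioo 0 ℓ)) :=
    (hbi ψ hψd.continuous hψc).smul m
  rw [integral_sub (hbi φ hφ.continuous hc) hsm, integral_smul, ← hcdef] at h0
  simp only [smul_sub]
  rw [integral_sub (hbi φ hφ.continuous hc) (hφi.restrict.smul_const c), integral_smul_const, hm']
  exact h0

theorem exists_continuousOn_rep {F : Type*} [NormedAddCommGroup F] [NormedSpace ℝ F]
    [CompleteSpace F] {ℓ : ℝ} (hℓ : 0 < ℓ) (u g : ℝ → F)
    (hu : Integrable u (volume.restrict (Ioo 0 ℓ))) (hg : Integrable g (volume.restrict (Ioo 0 ℓ)))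
    (h : ∀ φ : ℝ → ℝ, ContDiff ℝ ∞ φ → HasCompactSupport φ → tsupport φ ⊆ Ioo 0 ℓ →
      ∫ x in Ioo 0 ℓ, deriv φ x • u x = - ∫ x in Ioo 0 ℓ, φ x • g x) :
    ∃ f : ℝ → F, ContinuousOn f (Icc 0 ℓ) ∧ ∀ᵐ x ∂(volume.restrict (Ioo 0 ℓ)), u x = f x := by
  let G : ℝ → F := fun x => ∫ t in Ioc 0 x, g t ∂(volume.restrict (Ioo 0 ℓ))
  have hG : ContinuousOn G (Icc 0 ℓ) :=
    intervalIntegral.continuousOn_primitive hg.integrableOn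
  have hGi : Integrable G (volume.restrict (Ioo 0 ℓ)) :=
    (hG.integrableOn_compact isCompact_Icc).mono_set Ioo_subset_Icc_self
  obtain ⟨c, hc⟩ := ae_eq_const_of_integral_deriv_smul hℓ (fun x => u x - G x) (hu.sub hGi) (by
    intro φ hφ hφc hφs
    have hd : Continuous (deriv φ) := hφ.continuous_deriv (by norm_num)
    obtain ⟨C, hC⟩ := hd.bounded_above_of_compact_support hφc.deriv
    simp only [smul_sub]
    have i1 : Integrable (fun x => deriv φ x • u x) (volume.restrict (Ioo 0 ℓ)) :=
      hu.bdd_smul C hd.aestronglyMeasurable (Eventually.of_forall hC)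
    have i2 : Integrable (fun x => deriv φ x • G x) (volume.restrict (Ioo 0 ℓ)) :=
      hGi.bdd_smul C hd.aestronglyMeasurable (Eventually.of_forall hC)
    rw [integral_sub i1 i2, h φ hφ hφc hφs,
      integral_deriv_smul_primitive g hg φ hφ hφc hφs, sub_self])
  refine ⟨fun x => c + G x, continuousOn_const.add hG, ?_⟩
  filter_upwards [hc] with x hx
  rw [← hx]; abel

theorem eqOn_of_ae_eq {F : Type*} [NormedAddCommGroup F] {ℓ : ℝ} (hℓ : 0 < ℓ) {f₁ f₂ : ℝ → F}
    (h₁ : ContinuousOn f₁ (Icc 0 ℓ)) (h₂ : ContinuousOn f₂ (Icc 0 ℓ))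
    (h : ∀ᵐ x ∂(volume.restrict (Ioo 0 ℓ)), f₁ x = f₂ x) : EqOn f₁ f₂ (Icc 0 ℓ) :=
  Measure.eqOn_Icc_of_ae_eq volume hℓ.ne (by rwa [← restrict_Ioo_eq_restrict_Icc]) h₁ h₂

/-- `L²(0, ℓ)ⁿ`. -/
abbrev EdgeL2 (ℓ : ℝ) (n : ℕ) : Type :=
  Lp (EuclideanSpace ℂ (Fin n)) 2 (volume.restrict (Ioo (0 : ℝ) ℓ))

/-- `g` is the weak derivative of `u` on `(0, ℓ)`. -/
def HasWeakDeriv {ℓ : ℝ} {n : ℕ} (u g : EdgeL2 ℓ n) : Prop :=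
  ∀ φ : ℝ → ℝ, ContDiff ℝ ∞ φ → HasCompactSupport φ → tsupport φ ⊆ Ioo 0 ℓ →
    ∫ x in Ioo 0 ℓ, deriv φ x • u x = - ∫ x in Ioo 0 ℓ, φ x • g x

theorem EdgeL2.integrable {ℓ : ℝ} {n : ℕ} (u : EdgeL2 ℓ n) :
    Integrable u (volume.restrict (Ioo (0 : ℝ) ℓ)) :=
  (Lp.memLp u).integrable one_le_two

theorem EdgeL2.integrable_smul {ℓ : ℝ} {n : ℕ} (u : EdgeL2 ℓ n) {φ : ℝ → ℝ}
    (hφ : Continuous φ) (hc : HasCompactSupport φ) :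
    Integrable (fun x => φ x • u x) (volume.restrict (Ioo (0 : ℝ) ℓ)) := by
  obtain ⟨C, hC⟩ := hφ.bounded_above_of_compact_support hc
  exact u.integrable.bdd_smul C hφ.aestronglyMeasurable (Eventually.of_forall hC)

theorem HasWeakDeriv.add {ℓ : ℝ} {n : ℕ} {u g u' g' : EdgeL2 ℓ n} (h : HasWeakDeriv u g)
    (h' : HasWeakDeriv u' g') : HasWeakDeriv (u + u') (g + g') := by
  intro φ hφ hc hs
  have hd : Continuous (deriv φ) := hφ.continuous_deriv (by norm_num)
  have e1 : ∀ (θ : ℝ → ℝ) (a b : EdgeL2 ℓ n), Continuous θ → HasCompactSupport θ →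
      ∫ x in Ioo 0 ℓ, θ x • (a + b : EdgeL2 ℓ n) x
        = (∫ x in Ioo 0 ℓ, θ x • a x) + ∫ x in Ioo 0 ℓ, θ x • b x := by
    intro θ a b h1 h2
    rw [← integral_add (a.integrable_smul h1 h2) (b.integrable_smul h1 h2)]
    refine integral_congr_ae ?_
    filter_upwards [Lp.coeFn_add a b] with x hx
    rw [hx, Pi.add_apply, smul_add]
  rw [e1 _ _ _ hd hc.deriv, e1 _ _ _ hφ.continuous hc, h φ hφ hc hs, h' φ hφ hc hs, neg_add]

theorem HasWeakDeriv.smul {ℓ : ℝ} {n : ℕ} {u g : EdgeL2 ℓ n} (c : ℂ) (h : HasWeakDeriv u g) :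
    HasWeakDeriv (c • u) (c • g) := by
  intro φ hφ hc hs
  have e1 : ∀ (θ : ℝ → ℝ) (a : EdgeL2 ℓ n),
      ∫ x in Ioo 0 ℓ, θ x • (c • a : EdgeL2 ℓ n) x = c • ∫ x in Ioo 0 ℓ, θ x • a x := by
    intro θ a
    rw [← integral_smul]
    refine integral_congr_ae ?_
    filter_upwards [Lp.coeFn_smul c a] with x hx
    rw [hx, Pi.smul_apply, smul_comm]
  rw [e1, e1, h φ hφ hc hs, smul_neg]

theorem HasWeakDeriv.zero {ℓ : ℝ} {n : ℕ} : HasWeakDeriv (0 : EdgeL2 ℓ n) 0 := by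
  intro φ _ _ _
  have e1 : ∀ θ : ℝ → ℝ, ∫ x in Ioo 0 ℓ, θ x • (0 : EdgeL2 ℓ n) x = 0 := by
    intro θ
    refine integral_eq_zero_of_ae ?_
    filter_upwards [Lp.coeFn_zero (EuclideanSpace ℂ (Fin n)) 2
      (volume.restrict (Ioo (0 : ℝ) ℓ))] with x hx
    rw [hx, Pi.zero_apply, smul_zero]
  rw [e1, e1, neg_zero]

theorem HasWeakDeriv.unique {ℓ : ℝ} {n : ℕ} {u g g' : EdgeL2 ℓ n} (h : HasWeakDeriv u g)
    (h' : HasWeakDeriv u g') : g = g' := by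
  have key := isOpen_Ioo.ae_eq_zero_of_integral_contDiff_smul_eq_zero
    (μ := volume.restrict (Ioo 0 ℓ)) (U := Ioo (0 : ℝ) ℓ) (f := fun x => g x - g' x)
    ((g.integrable.sub g'.integrable).locallyIntegrable.locallyIntegrableOn _) ?_
  · apply Lp.ext
    filter_upwards [key, ae_restrict_mem measurableSet_Ioo] with x hx hx'
    exact sub_eq_zero.1 (hx hx')
  intro φ hφ hc hs
  simp only [smul_sub]
  rw [integral_sub (g.integrable_smul hφ.continuous hc) (g'.integrable_smul hφ.continuous hc),
    sub_eq_zero, ← neg_inj, ← h φ hφ hc hs, h' φ hφ hc hs]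

/-- The Sobolev space `H¹(0, ℓ)ⁿ`, as a subspace of `L²(0, ℓ)ⁿ`. -/
def EdgeH1 (ℓ : ℝ) (n : ℕ) : Submodule ℂ (EdgeL2 ℓ n) where
  carrier := {u | ∃ g, HasWeakDeriv u g}
  add_mem' := fun ⟨_, h⟩ ⟨_, h'⟩ => ⟨_, h.add h'⟩
  zero_mem' := ⟨0, HasWeakDeriv.zero⟩
  smul_mem' := fun c _ ⟨_, h⟩ => ⟨_, h.smul c⟩

/-- The weak derivative `u ↦ u'` on `H¹(0, ℓ)ⁿ`. -/
noncomputable def weakDeriv {ℓ : ℝ} {n : ℕ} : EdgeH1 ℓ n →ₗ[ℂ] EdgeL2 ℓ n where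
  toFun u := u.2.choose
  map_add' u v := (u + v).2.choose_spec.unique (u.2.choose_spec.add v.2.choose_spec)
  map_smul' c u := (c • u).2.choose_spec.unique (u.2.choose_spec.smul c)

theorem exists_rep_of_edgeH1 {ℓ : ℝ} {n : ℕ} (hℓ : 0 < ℓ) (u : EdgeH1 ℓ n) :
    ∃ f : ℝ → EuclideanSpace ℂ (Fin n), ContinuousOn f (Icc 0 ℓ) ∧
      ∀ᵐ x ∂(volume.restrict (Ioo 0 ℓ)), (u : EdgeL2 ℓ n) x = f x := by
  obtain ⟨u, g, h⟩ := u
  exact exists_continuousOn_rep hℓ u g u.integrable g.integrable h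

/-- The value `u(a)`, at a point `a` of `[0, ℓ]`, of the continuous representative of
`u ∈ H¹(0, ℓ)ⁿ`. -/
noncomputable def pointValue {ℓ : ℝ} {n : ℕ} (hℓ : 0 < ℓ) (a : Icc (0 : ℝ) ℓ) :
    EdgeH1 ℓ n →ₗ[ℂ] EuclideanSpace ℂ (Fin n) where
  toFun u := (exists_rep_of_edgeH1 hℓ u).choose a
  map_add' u v := by
    obtain ⟨h1, h2⟩ := (exists_rep_of_edgeH1 hℓ u).choose_spec
    obtain ⟨k1, k2⟩ := (exists_rep_of_edgeH1 hℓ v).choose_spec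
    obtain ⟨l1, l2⟩ := (exists_rep_of_edgeH1 hℓ (u + v)).choose_spec
    refine eqOn_of_ae_eq hℓ l1 (h1.add k1) ?_ a.2
    filter_upwards [h2, k2, l2, Lp.coeFn_add (u : EdgeL2 ℓ n) v] with x a1 a2 a3 a4
    rw [← a3, Pi.add_apply, ← a1, ← a2]
    exact a4
  map_smul' c u := by
    obtain ⟨h1, h2⟩ := (exists_rep_of_edgeH1 hℓ u).choose_spec
    obtain ⟨l1, l2⟩ := (exists_rep_of_edgeH1 hℓ (c • u)).choose_spec
    refine eqOn_of_ae_eq hℓ l1 (h1.const_smul c) ?_ a.2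
    filter_upwards [h2, l2, Lp.coeFn_smul c (u : EdgeL2 ℓ n)] with x a1 a3 a4
    rw [← a3, Pi.smul_apply, ← a1]
    exact a4

theorem memLp_mulVec {ℓ : ℝ} {n : ℕ} {F : ℝ → Matrix (Fin n) (Fin n) ℂ}
    (hF : ∀ i j, MemLp (fun x => F x i j) ∞ (volume.restrict (Ioo (0 : ℝ) ℓ)))
    (u : EdgeL2 ℓ n) :
    MemLp (fun x => Matrix.toEuclideanLin (F x) (u x)) 2 (volume.restrict (Ioo (0 : ℝ) ℓ)) := by
  have h : ∀ i j, MemLp (fun x => F x i j • ((u x) j • EuclideanSpace.single i (1 : ℂ))) 2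
      (volume.restrict (Ioo (0 : ℝ) ℓ)) := by
    intro i j
    refine MemLp.smul (p := ∞) (q := 2) (r := 2) ?_ (hF i j)
    exact ((EuclideanSpace.proj j : EuclideanSpace ℂ (Fin n) →L[ℂ] ℂ).smulRight
      (EuclideanSpace.single i (1 : ℂ))).comp_memLp' (Lp.memLp u)
  have h' := memLp_finsetSum Finset.univ fun i _ => memLp_finsetSum Finset.univ fun j _ => h i j
  refine h'.ae_eq (Eventually.of_forall fun x => ?_)
  ext k
  simp only [WithLp.ofLp_sum, Finset.sum_apply, PiLp.smul_apply, smul_eq_mul, PiLp.single_apply,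
    Matrix.toLpLin_apply, Matrix.mulVec, dotProduct]
  rw [Finset.sum_eq_single k]
  · simp
  · intro b _ hb
    simp [Ne.symm hb]
  · simp

/-- Multiplication `u ↦ F u` by an essentially bounded matrix-valued function `F`. -/
noncomputable def matrixMul {ℓ : ℝ} {n : ℕ} (F : ℝ → Matrix (Fin n) (Fin n) ℂ)
    (hF : ∀ i j, MemLp (fun x => F x i j) ∞ (volume.restrict (Ioo (0 : ℝ) ℓ))) :
    EdgeL2 ℓ n →ₗ[ℂ] EdgeL2 ℓ n where
  toFun u := (memLp_mulVec hF u).toLp _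
  map_add' u v := by
    rw [← MemLp.toLp_add, MemLp.toLp_eq_toLp_iff]
    filter_upwards [Lp.coeFn_add u v] with x hx
    rw [hx, Pi.add_apply, Pi.add_apply, map_add]
  map_smul' c u := by
    rw [RingHom.id_apply, ← MemLp.toLp_const_smul, MemLp.toLp_eq_toLp_iff]
    filter_upwards [Lp.coeFn_smul c u] with x hx
    rw [hx, Pi.smul_apply, Pi.smul_apply, map_smul]

theorem memLp_top_of_lipschitz {ℓ : ℝ} {f : ℝ → ℂ} {K : ℝ≥0}
    (hf : LipschitzOnWith K f (Icc 0 ℓ)) : MemLp f ∞ (volume.restrict (Ioo (0 : ℝ) ℓ)) := by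
  have hc := hf.continuousOn
  obtain ⟨C, hC⟩ := isCompact_Icc.exists_bound_of_continuousOn hc
  refine memLp_top_of_bound ((hc.mono Ioo_subset_Icc_self).aestronglyMeasurable
    measurableSet_Ioo) C ?_
  filter_upwards [ae_restrict_mem measurableSet_Ioo] with x hx
  exact hC x (Ioo_subset_Icc_self hx)

/-- A finite metric graph without loops. The edge `e` is the interval `[0, length e]`, with `0` at
its initial and `length e` at its terminal endpoint, and carries functions with values in
`ℂ ^ (dim e)`. -/
structure Network (V E : Type*) where
  src : E → V
  tgt : E → V
  src_ne_tgt : ∀ e, src e ≠ tgt e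
  dim : E → ℕ
  dim_pos : ∀ e, 0 < dim e
  length : E → ℝ
  length_pos : ∀ e, 0 < length e

namespace Network

variable {V E : Type*} [Fintype V] [Fintype E] (G : Network V E)

/-- The set of edges incident in the vertex `v`. -/
def Incident (v : V) : Type _ := {e : E // G.src e = v ∨ G.tgt e = v}

noncomputable instance (v : V) : Fintype (G.Incident v) :=
  @Fintype.ofFinite _ (inferInstanceAs (Finite {e : E // G.src e = v ∨ G.tgt e = v}))

noncomputable instance (v : V) : DecidableEq (G.Incident v) := Classical.decEq _

/-- The space `ℂ^{k_v}`, whose vectors are the families `(w_e)` over the edges `e` incident in `v`,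
with `w_e ∈ ℂ ^ (dim e)`. -/
abbrev VertexSpace (v : V) : Type _ :=
  EuclideanSpace ℂ (Σ e : G.Incident v, Fin (G.dim e.1))

/-- The space `ℂ^k`, whose vectors are the families `(w_e)` over all edges `e`. -/
abbrev TotalSpace : Type _ := EuclideanSpace ℂ (Σ e : E, Fin (G.dim e))

open Classical in
/-- The extension by zero `w ↦ w̃` from `ℂ^{k_v}` to `ℂ^k`. -/
noncomputable def extend (v : V) (w : G.VertexSpace v) : G.TotalSpace :=
  WithLp.toLp 2 fun p =>
    if h : G.src p.1 = v ∨ G.tgt p.1 = v then w ⟨⟨p.1, h⟩, p.2⟩ else 0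

open Classical in
/-- The position of the vertex `v` on the incident edge `e`. -/
noncomputable def position (v : V) (e : G.Incident v) : Icc (0 : ℝ) (G.length e.1) :=
  if G.tgt e.1 = v then ⟨G.length e.1, (G.length_pos e.1).le, le_rfl⟩
  else ⟨0, le_rfl, (G.length_pos e.1).le⟩

open Classical in
/-- The entries of the signed incidence matrix. -/
noncomputable def incidence (v : V) (e : E) : ℂ :=
  (if G.tgt e = v then 1 else 0) - (if G.src e = v then 1 else 0)

/-- The Hilbert space `L²(𝒢)`, the direct sum of the spaces `L²(0, ℓ_e)^{k_e}`. -/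
abbrev L2 : Type _ := PiLp 2 fun e : E => EdgeL2 (G.length e) (G.dim e)

/-- `D_max`, the direct sum of the spaces `H¹(0, ℓ_e)^{k_e}`. -/
def Dmax : Submodule ℂ G.L2 where
  carrier := {u | ∀ e, u e ∈ EdgeH1 (G.length e) (G.dim e)}
  add_mem' hu hv e := add_mem (hu e) (hv e)
  zero_mem' e := zero_mem (EdgeH1 (G.length e) (G.dim e))
  smul_mem' c _ hu e := Submodule.smul_mem _ c (hu e)

/-- The component on the edge `e` of an element of `D_max`. -/
def edgePart (e : E) : G.Dmax →ₗ[ℂ] EdgeH1 (G.length e) (G.dim e) where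
  toFun u := ⟨u.1 e, u.2 e⟩
  map_add' _ _ := rfl
  map_smul' _ _ := rfl

/-- The trace operator `γ_v(u) = (u_e(v))` over the edges `e` incident in `v`. -/
noncomputable def trace (v : V) : G.Dmax →ₗ[ℂ] G.VertexSpace v where
  toFun u := WithLp.toLp 2 fun p =>
    pointValue (G.length_pos p.1.1) (G.position v p.1) (G.edgePart p.1.1 u) p.2
  map_add' u u' := by
    ext p
    simp
  map_smul' c u := by
    ext p
    simp

/-- The coefficient functions `M_e`, `N_e` and a Friedrichs symmetrizer `Q_e`. -/
structure Coefficients where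
  M : ∀ e, ℝ → Matrix (Fin (G.dim e)) (Fin (G.dim e)) ℂ
  N : ∀ e, ℝ → Matrix (Fin (G.dim e)) (Fin (G.dim e)) ℂ
  Q : ∀ e, ℝ → Matrix (Fin (G.dim e)) (Fin (G.dim e)) ℂ
  M_lipschitz : ∀ e, ∃ K : ℝ≥0, ∀ i j,
    LipschitzOnWith K (fun x => M e x i j) (Icc 0 (G.length e))
  M_invertible : ∀ e, ∀ x ∈ Icc 0 (G.length e), IsUnit (M e x)
  N_bounded : ∀ e i j, MemLp (fun x => N e x i j) ∞ (volume.restrict (Ioo 0 (G.length e)))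
  Q_lipschitz : ∀ e, ∃ K : ℝ≥0, ∀ i j,
    LipschitzOnWith K (fun x => Q e x i j) (Icc 0 (G.length e))
  Q_hermitian : ∀ e, ∀ x ∈ Icc 0 (G.length e), (Q e x).IsHermitian
  QM_hermitian : ∀ e, ∀ x ∈ Icc 0 (G.length e), (Q e x * M e x).IsHermitian
  Q_pos : ∀ e, ∃ q : ℝ, 0 < q ∧ ∀ x ∈ Icc 0 (G.length e),
    ∀ ξ : EuclideanSpace ℂ (Fin (G.dim e)),
      q * ‖ξ‖ ^ 2 ≤ (inner ℂ ξ (Matrix.toEuclideanLin (Q e x) ξ)).re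

/-- The spaces and operators defining the vertex conditions. -/
structure VertexConditions where
  Y : ∀ v, Submodule ℂ (G.VertexSpace v)
  Yd : ∀ v, Submodule ℂ (G.VertexSpace v)
  Yd_le : ∀ v, Yd v ≤ Y v
  B : ∀ v, Y v →ₗ[ℂ] Yd v
  C : ∀ v, Yd v →ₗ[ℂ] Yd v
  Q : ∀ v, Yd v →ₗ[ℂ] Yd v
  Q_symmetric : ∀ v, ∀ x y : Yd v, inner ℂ (Q v x) y = inner ℂ x (Q v y)
  Q_pos : ∀ v, ∀ x : Yd v, x ≠ 0 → 0 < (inner ℂ x (Q v x)).re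

variable {G}

namespace Coefficients

variable (c : G.Coefficients)

/-- The operator `(𝒜 u)_e = M_e u_e' + N_e u_e` on `D_max`. -/
noncomputable def opA : G.Dmax →ₗ[ℂ] G.L2 where
  toFun u := WithLp.toLp 2 fun e =>
    matrixMul (c.M e) (fun i j => memLp_top_of_lipschitz ((c.M_lipschitz e).choose_spec i j))
        (weakDeriv (G.edgePart e u)) +
      matrixMul (c.N e) (c.N_bounded e) (u.1 e)
  map_add' u u' := by
    ext1 e
    simp only [map_add, PiLp.add_apply, Submodule.coe_add]
    abel
  map_smul' a u := by
    ext1 e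
    simp only [map_smul, PiLp.smul_apply, Submodule.coe_smul, smul_add, RingHom.id_apply]

/-- The block-diagonal matrix `T_v` with the blocks `ι_{ve} Q_e(v) M_e(v)`. -/
noncomputable def T (v : V) : G.VertexSpace v →ₗ[ℂ] G.VertexSpace v :=
  Matrix.toEuclideanLin <| Matrix.blockDiagonal' fun e : G.Incident v =>
    G.incidence v e.1 • (c.Q e.1 (G.position v e) * c.M e.1 (G.position v e))

end Coefficients

namespace VertexConditions

variable (b : G.VertexConditions)

/-- `Y^{(d)}`, the direct sum of the spaces `Y_v^{(d)}`. -/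
abbrev BoundarySpace : Type _ := PiLp 2 fun v : V => b.Yd v

/-- The Hilbert space `L²_d(𝒢) = L²(𝒢) ⊕ Y^{(d)}`. Its canonical norm is used; it is equivalent to
the one weighted with the `Q_e` and `Q_v`, hence gives the same strongly continuous semigroups. -/
abbrev StateSpace : Type _ := WithLp 2 (G.L2 × b.BoundarySpace)

/-- The orthogonal projector `P_v^{(d)}` of `ℂ^{k_v}` onto `Y_v^{(d)}`. -/
noncomputable def P (v : V) : G.VertexSpace v →ₗ[ℂ] b.Yd v :=
  (b.Yd v).orthogonalProjectionOnto.toLinearMap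

/-- The adjoint `B_v^* : Y_v^{(d)} → Y_v` for the Euclidean inner products. -/
noncomputable def Bstar (v : V) : b.Yd v →ₗ[ℂ] b.Y v :=
  LinearMap.adjoint (𝕜 := ℂ) (E := b.Y v) (F := b.Yd v) (b.B v)

/-- The domain of `𝔸`: all `(u, x)` in `D_max ⊕ Y^{(d)}` with `γ_v(u) ∈ Y_v` and
`x_v = P_v^{(d)} γ_v(u)` for all `v`. -/
def domain : Submodule ℂ b.StateSpace where
  carrier := {z | ∃ hu : z.fst ∈ G.Dmax, ∀ v,
    G.trace v ⟨z.fst, hu⟩ ∈ b.Y v ∧ z.snd v = b.P v (G.trace v ⟨z.fst, hu⟩)}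
  add_mem' := by
    rintro z z' ⟨hu, h⟩ ⟨hu', h'⟩
    refine ⟨add_mem hu hu', fun v => ?_⟩
    have e : G.trace v ⟨(z + z').fst, add_mem hu hu'⟩
      = G.trace v ⟨z.fst, hu⟩ + G.trace v ⟨z'.fst, hu'⟩ := by rw [← map_add]; rfl
    rw [e, map_add, ← (h v).2, ← (h' v).2]
    exact ⟨add_mem (h v).1 (h' v).1, rfl⟩
  zero_mem' := by
    refine ⟨zero_mem _, fun v => ?_⟩
    have e : G.trace v ⟨(0 : b.StateSpace).fst, zero_mem _⟩ = 0 := (G.trace v).map_zero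
    rw [e, map_zero]
    exact ⟨zero_mem _, rfl⟩
  smul_mem' := by
    rintro a z ⟨hu, h⟩
    refine ⟨Submodule.smul_mem _ a hu, fun v => ?_⟩
    have e : G.trace v ⟨(a • z).fst, Submodule.smul_mem _ a hu⟩
      = a • G.trace v ⟨z.fst, hu⟩ := by rw [← map_smul]; rfl
    rw [e, map_smul, ← (h v).2]
    exact ⟨Submodule.smul_mem _ a (h v).1, rfl⟩

/-- The first component of an element of the domain of `𝔸`. -/
def domainFst : b.domain →ₗ[ℂ] G.Dmax where
  toFun z := ⟨z.1.fst, z.2.choose⟩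
  map_add' _ _ := rfl
  map_smul' _ _ := rfl

/-- The trace `γ_v(u) ∈ Y_v` of an element `(u, x)` of the domain of `𝔸`. -/
noncomputable def domainTrace (v : V) : b.domain →ₗ[ℂ] b.Y v :=
  ((G.trace v).comp b.domainFst).codRestrict (b.Y v) fun z => (z.2.choose_spec v).1

/-- The second row `(ℬ u + 𝒞 x)_v = B_v γ_v(u) + C_v x_v` of `𝔸`, on the domain of `𝔸`. -/
noncomputable def opBC : b.domain →ₗ[ℂ] b.BoundarySpace where
  toFun z := WithLp.toLp 2 fun v => b.B v (b.domainTrace v z) + b.C v (z.1.snd v)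
  map_add' z z' := by
    ext1 v
    simp only [map_add, Submodule.coe_add, WithLp.add_snd, PiLp.add_apply]
    abel
  map_smul' a z := by
    ext1 v
    simp only [map_smul, Submodule.coe_smul, WithLp.smul_snd, PiLp.smul_apply, smul_add,
      RingHom.id_apply]

/-- The block operator matrix `𝔸 (u, x) = (𝒜 u, ℬ u + 𝒞 x)` as an unbounded operator on
`L²_d(𝒢)`. -/
noncomputable def blockOperator (c : G.Coefficients) : b.StateSpace →ₗ.[ℂ] b.StateSpace where
  domain := b.domain
  toFun := (WithLp.linearEquiv 2 ℂ (G.L2 × b.BoundarySpace)).symm.toLinearMap ∘ₗ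
    (c.opA ∘ₗ b.domainFst).prod b.opBC

/-- The operator `T_v + Q_v B_v + B_v^* Q_v - r P_v^{(d)} Q_v P_v^{(d)}` from `Y_v` to `ℂ^{k_v}`,
where `Q_v` is extended by `0` to the orthogonal complement of `Y_v^{(d)}`. -/
noncomputable def formOperator (c : G.Coefficients) (r : ℝ) (v : V) :
    b.Y v →ₗ[ℂ] G.VertexSpace v :=
  let P' : b.Y v →ₗ[ℂ] b.Yd v := b.P v ∘ₗ (b.Y v).subtype
  c.T v ∘ₗ (b.Y v).subtype + (b.Yd v).subtype ∘ₗ b.Q v ∘ₗ b.B v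
    + (b.Y v).subtype ∘ₗ b.Bstar v ∘ₗ b.Q v ∘ₗ P'
    - (r : ℂ) • ((b.Yd v).subtype ∘ₗ b.Q v ∘ₗ P')

/-- `Y_v` is contained in the nonpositive isotropic cone of the quadratic form associated with
`T_v + Q_v B_v + B_v^* Q_v - r P_v^{(d)} Q_v P_v^{(d)}`. -/
def InNonposCone (c : G.Coefficients) (r : ℝ) (v : V) : Prop :=
  ∀ ξ : b.Y v, (inner ℂ (ξ : G.VertexSpace v) (b.formOperator c r v ξ)).re ≤ 0

open Module in
/-- The family of the extensions to `ℂ^k`, over all vertices `v`, of the vectors of a basis of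
`Y_v^⊥`, of the images under `B_v^*` of the vectors of a basis of `Ran B_v`, and of the vectors of
a basis of `Ker B_v^*`. -/
noncomputable def extendedVectors
    (w : ∀ v, Basis (Fin (finrank ℂ (b.Y v)ᗮ)) ℂ (b.Y v)ᗮ)
    (y : ∀ v, Basis (Fin (finrank ℂ (b.B v).range)) ℂ (b.B v).range)
    (wK : ∀ v, Basis (Fin (finrank ℂ (b.Bstar v).ker)) ℂ (b.Bstar v).ker) :
    (Σ v : V, Fin (finrank ℂ (b.Y v)ᗮ) ⊕ Fin (finrank ℂ (b.B v).range) ⊕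
      Fin (finrank ℂ (b.Bstar v).ker)) → G.TotalSpace
  | ⟨v, .inl i⟩ => G.extend v (w v i : G.VertexSpace v)
  | ⟨v, .inr (.inl j)⟩ => G.extend v (b.Bstar v (y v j : b.Yd v) : G.VertexSpace v)
  | ⟨v, .inr (.inr l)⟩ => G.extend v ((wK v l : b.Yd v) : G.VertexSpace v)

end VertexConditions

end Network

/-- A strongly continuous semigroup of bounded linear operators on `X`. -/
structure C0Semigroup (X : Type*) [NormedAddCommGroup X] [NormedSpace ℂ X] where
  S : ℝ≥0 → X →L[ℂ] X
  map_zero : S 0 = ContinuousLinearMap.id ℂ X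
  map_add : ∀ s t, S (s + t) = (S s).comp (S t)
  continuous_orbit : ∀ x, Continuous fun t => S t x

/-- `A` is the generator of the semigroup `S`: `x ∈ D(A)` and `A x = y` if and only if
`(S(h) x - x) / h` tends to `y` as `h → 0+`. -/
def C0Semigroup.IsGeneratedBy {X : Type*} [NormedAddCommGroup X] [NormedSpace ℂ X]
    (S : C0Semigroup X) (A : X →ₗ.[ℂ] X) : Prop :=
  ∀ x y : X, (x, y) ∈ A.graph ↔
    Tendsto (fun h : ℝ≥0 => (h : ℂ)⁻¹ • (S.S h x - x)) (𝓝[>] 0) (𝓝 y)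

/-! Weighting L²(𝒢) by the Q_e and Y^{(d)} by the Q_v gives an equivalent inner product in which 𝔸
is quasi-dissipative. Together with a range condition this yields the semigroup by the
Lumer–Phillips theorem, proved here by Yosida approximation
(`exists_C0Semigroup_of_quasiDissipative`).

Dissipativity: Q_e M_e is Hermitian and Lipschitz, so integrating by parts on an edge turns 2 Re ⟨u,
Q_e M_e u'⟩ into the endpoint values of the form Q_e M_e, up to an error O(‖u‖²) caused by (Q_e
M_e)' (`two_mul_integral_re_inner_le`). Regrouped by vertices, the endpoint values add up to the sum
of the forms T_v at γ_v(u) (`sum_re_inner_T`). The second row of 𝔸 contributes 2 Re ⟨x_v, Q_v B_v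
γ_v(u)⟩, and since x_v = P_v γ_v(u), the cone condition bounds this plus the T_v-term by λ ⟨x_v, Q_v
x_v⟩ (`re_inner_add_two_mul_le_of_cone`). The terms with N_e and C_v are bounded perturbations.

Range: M_e is invertible, so μu - 𝒜u = f is a linear ODE on each edge, solvable for any initial
values in ℂ^k (`exists_opA_eq`). What remains is to choose these k parameters so that the vertex
conditions hold. There are dim Y_v^⊥ + dim Y_v^{(d)} conditions at v, and dim Y_v^{(d)} = dim Ran
B_v + dim Ker B_v^*; the basis hypothesis says that the total is k (`sum_finrank_eq`). The linear
system is therefore square. For large real μ it is injective by quasi-dissipativity, hence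
surjective (`IsCoupledOperator.exists_resolvent_eq`). -/

/-! ### Semigroups as limits of exponentials of bounded operators -/

section Semigroup

variable {X : Type*} [NormedAddCommGroup X] [NormedSpace ℂ X]

theorem cauchySeq_apply_of_dense {T : ℕ → X →L[ℂ] X} {M : ℝ} (hM : ∀ n, ‖T n‖ ≤ M)
    {D : Set X} (hD : Dense D) (h : ∀ x ∈ D, CauchySeq fun n => T n x) (x : X) :
    CauchySeq fun n => T n x := by
  have hM0 : 0 ≤ M := (norm_nonneg _).trans (hM 0)
  rw [Metric.cauchySeq_iff']
  intro ε hε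
  obtain ⟨z, hz, hzx⟩ := Metric.dense_iff.1 hD x (ε / (3 * (M + 1))) (by positivity)
  obtain ⟨N, hN⟩ := Metric.cauchySeq_iff'.1 (h z hzx) (ε / 3) (by positivity)
  refine ⟨N, fun n hn => ?_⟩
  have h1 : ∀ k, dist (T k x) (T k z) < ε / 3 := by
    intro k
    rw [dist_eq_norm, ← map_sub]
    have hz' : ‖x - z‖ < ε / (3 * (M + 1)) := by
      rw [← dist_eq_norm, dist_comm]; exact hz
    calc ‖T k (x - z)‖ ≤ M * ‖x - z‖ := (T k).le_of_opNorm_le (hM k) _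
      _ ≤ (M + 1) * ‖x - z‖ := by gcongr; linarith
      _ < (M + 1) * (ε / (3 * (M + 1))) := by gcongr
      _ = ε / 3 := by field_simp
  have h2 := hN n hn
  have h3 := dist_triangle4 (T n x) (T n z) (T N z) (T N x)
  have h4 := h1 N
  rw [dist_comm] at h4
  linarith [h1 n]

theorem tendsto_apply_of_dense {ι : Type*} {l : Filter ι} {T : ι → X →L[ℂ] X} {T' : X →L[ℂ] X}
    {M : ℝ} (hM : ∀ᶠ n in l, ‖T n‖ ≤ M)
    {D : Set X} (hD : Dense D) (h : ∀ x ∈ D, Tendsto (fun n => T n x) l (𝓝 (T' x))) (x : X) :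
    Tendsto (fun n => T n x) l (𝓝 (T' x)) := by
  rw [Metric.tendsto_nhds]
  intro ε hε
  -- One positive bound for both `T'` and the tail of the `T n`; `M` itself may be negative when `l`
  -- is trivial.
  set K : ℝ := max M 0 + ‖T'‖ + 1 with hK
  have hM0 : 0 ≤ max M 0 := le_max_right _ _
  have hK0 : 0 < K := by positivity
  obtain ⟨z, hz, hzx⟩ := Metric.dense_iff.1 hD x (ε / (3 * K)) (by positivity)
  have hz' : ‖x - z‖ < ε / (3 * K) := by rw [← dist_eq_norm, dist_comm]; exact hz
  have e : K * (ε / (3 * K)) = ε / 3 := by field_simp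
  have h1 : ∀ B : X →L[ℂ] X, ‖B‖ ≤ K → dist (B x) (B z) < ε / 3 := by
    intro B hB
    rw [dist_eq_norm, ← map_sub]
    calc ‖B (x - z)‖ ≤ K * ‖x - z‖ := B.le_of_opNorm_le hB _
      _ < K * (ε / (3 * K)) := by gcongr
      _ = ε / 3 := e
  filter_upwards [hM, Metric.tendsto_nhds.1 (h z hzx) (ε / 3) (by positivity)] with n hn hnz
  have h2 := h1 (T n) (hn.trans (by rw [hK]; linarith [le_max_left M 0, norm_nonneg T']))
  have h4 := h1 T' (by rw [hK]; linarith)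
  rw [dist_comm] at h4
  linarith [dist_triangle4 (T n x) (T n z) (T' z) (T' x)]

variable [CompleteSpace X]

open NormedSpace in
-- The curve s ↦ exp(sA) exp((t - s)B) x joins exp(tB) x to exp(tA) x. Because A and B commute, its
-- derivative is exp(sA) exp((t - s)B) (A - B) x, of norm at most M² ‖Ax - Bx‖.
theorem norm_exp_smul_sub_exp_smul_le {A B : X →L[ℂ] X} (hAB : Commute A B) {M : ℝ}
    (hA : ∀ t : ℝ, 0 ≤ t → ‖exp (t • A)‖ ≤ M) (hB : ∀ t : ℝ, 0 ≤ t → ‖exp (t • B)‖ ≤ M)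
    {t : ℝ} (ht : 0 ≤ t) (x : X) :
    ‖exp (t • A) x - exp (t • B) x‖ ≤ M * (M * ‖A x - B x‖) * t := by
  have hM0 : 0 ≤ M := (norm_nonneg _).trans (hA 0 le_rfl)
  have hd : ∀ s : ℝ, HasDerivAt (fun s : ℝ => (exp (s • A) * exp ((t - s) • B)) x)
      ((exp (s • A) * exp ((t - s) • B) * (A - B)) x) s := by
    intro s
    have h1 := hasDerivAt_exp_smul_const (𝕂 := ℝ) A s
    have h2 : HasDerivAt (fun s : ℝ => exp ((t - s) • B)) (-(exp ((t - s) • B) * B)) s := by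
      have := (hasDerivAt_exp_smul_const (𝕂 := ℝ) B (t - s)).scomp s ((hasDerivAt_id s).const_sub t)
      simpa [Function.comp_def] using this
    have h3 := h1.mul h2
    have h4 : HasDerivAt (fun s : ℝ => exp (s • A) * exp ((t - s) • B))
        (exp (s • A) * exp ((t - s) • B) * (A - B)) s := by
      refine h3.congr_deriv ?_
      have h5 : A * exp ((t - s) • B) = exp ((t - s) • B) * A :=
        ((hAB.smul_right (t - s)).exp_right).eq
      rw [mul_assoc (exp (s • A)) A, h5]
      noncomm_ring
    exact ((ContinuousLinearMap.apply ℂ X x).restrictScalars ℝ).hasFDerivAt.comp_hasDerivAt s h4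
  have := norm_image_sub_le_of_norm_deriv_le_segment' (a := 0) (b := t)
    (fun s _ => (hd s).hasDerivWithinAt) (C := M * (M * ‖A x - B x‖)) (by
      intro s hs
      simp only [mul_apply_eq_comp, sub_apply]
      refine (ContinuousLinearMap.le_of_opNorm_le _ (hA s hs.1) _).trans ?_
      gcongr
      exact ContinuousLinearMap.le_of_opNorm_le _ (hB _ (by linarith [hs.2])) _)
    t (right_mem_Icc.2 ht)
  simpa using this

open NormedSpace in
theorem tendsto_exp_smul_sub_div (A : X →L[ℂ] X) (x : X) :
    Tendsto (fun h : ℝ≥0 => (h : ℂ)⁻¹ • (exp ((h : ℝ) • A) x - x)) (𝓝[>] 0) (𝓝 (A x)) := by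
  have h1 : HasDerivAt (fun t : ℝ => exp (t • A) x) (A x) 0 := by
    have h2 := hasDerivAt_exp_smul_const (𝕂 := ℝ) A 0
    have := ((ContinuousLinearMap.apply ℂ X x).restrictScalars ℝ).hasFDerivAt.comp_hasDerivAt
      (0 : ℝ) h2
    simpa [Function.comp_def] using this
  have h3 := h1.tendsto_slope_zero_right
  have h4 : Tendsto (fun h : ℝ≥0 => (h : ℝ)) (𝓝[>] 0) (𝓝[>] 0) := by
    refine tendsto_nhdsWithin_iff.2 ⟨?_, ?_⟩
    · exact (NNReal.continuous_coe.tendsto 0).mono_left nhdsWithin_le_nhds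
    · filter_upwards [self_mem_nhdsWithin] with h hh
      exact NNReal.coe_pos.2 hh
  refine (h3.comp h4).congr fun h => ?_
  simp only [Function.comp_apply, zero_add, zero_smul, NormedSpace.exp_zero,
    one_apply_eq_self]
  rw [← Complex.coe_smul]
  simp

open NormedSpace in
/-- A Hille–Yosida type generation theorem: an operator with nonempty resolvent set that is
approximated by commuting bounded operators generating uniformly bounded semigroups generates a
strongly continuous semigroup. -/
theorem exists_C0Semigroup_of_approx (A : X →ₗ.[ℂ] X) (hD : Dense (A.domain : Set X))
    (T : ℕ → X →L[ℂ] X) (hT : ∀ m n, Commute (T m) (T n)) {M : ℝ}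
    (hM : ∀ n (t : ℝ), 0 ≤ t → ‖exp (t • T n)‖ ≤ M)
    (hTA : ∀ x : A.domain, Tendsto (fun n => T n x) atTop (𝓝 (A x)))
    (μ : ℂ) (R : X →L[ℂ] X) (hR : ∀ x, ∃ h : R x ∈ A.domain, μ • R x - A ⟨R x, h⟩ = x)
    (hRT : ∀ n, Commute R (T n)) :
    ∃ S : C0Semigroup X, S.IsGeneratedBy A := by
  have hM0 : 0 ≤ M := (norm_nonneg _).trans (hM 0 0 le_rfl)
  have hcau : ∀ (t : ℝ≥0) (x : X), CauchySeq fun n => exp ((t : ℝ) • T n) x := by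
    intro t
    refine cauchySeq_apply_of_dense (fun n => hM n t t.2) hD fun x hx => ?_
    have hc := (hTA ⟨x, hx⟩).cauchySeq
    rw [Metric.cauchySeq_iff] at hc ⊢
    intro ε hε
    obtain ⟨N, hN⟩ := hc (ε / (M * M * t + 1)) (by positivity)
    refine ⟨N, fun m hm n hn => ?_⟩
    have h1 := norm_exp_smul_sub_exp_smul_le (hT m n) (hM m) (hM n) t.2 x
    have h2 := hN m hm n hn
    rw [dist_eq_norm] at h2 ⊢
    rw [lt_div_iff₀ (by positivity)] at h2
    have : 0 ≤ ‖T m x - T n x‖ := norm_nonneg _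
    calc _ ≤ _ := h1
      _ = ‖T m x - T n x‖ * (M * M * t) := by
        simp only [NNReal.val_eq_coe]; ring
      _ ≤ ‖T m x - T n x‖ * (M * M * t + 1) := by gcongr; linarith
      _ < ε := h2
  choose f hf using fun t x => cauchySeq_tendsto_of_complete (hcau t x)
  let S : ℝ≥0 → X →L[ℂ] X := fun t =>
    continuousLinearMapOfTendsto (fun n => exp ((t : ℝ) • T n)) (f := f t)
      (tendsto_pi_nhds.2 (hf t))
  have hS : ∀ (t : ℝ≥0) x, Tendsto (fun n => exp ((t : ℝ) • T n) x) atTop (𝓝 (S t x)) := hf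
  have hSM : ∀ t, ‖S t‖ ≤ M := by
    intro t
    refine ContinuousLinearMap.opNorm_le_bound _ hM0 fun x => ?_
    refine le_of_tendsto (hS t x).norm (Eventually.of_forall fun n => ?_)
    exact ContinuousLinearMap.le_of_opNorm_le _ (hM n t t.2) _
  -- The comparison of two exponentials, with one index sent to infinity. Linearity of the bound in
  -- t serves twice: for locally uniform convergence, and for difference quotients at 0.
  have hdiff : ∀ (t : ℝ≥0) (x : A.domain) (n : ℕ),
      ‖S t x - exp ((t : ℝ) • T n) x‖ ≤ M * (M * ‖A x - T n x‖) * t := by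
    intro t x n
    refine le_of_tendsto_of_tendsto ((hS t x).sub_const _).norm
      (((((hTA x).sub_const _).norm.const_mul M).const_mul M).mul_const (t : ℝ))
      (Eventually.of_forall fun m => ?_)
    exact norm_exp_smul_sub_exp_smul_le (hT m n) (hM m) (hM n) t.2 x
  have hcontT : ∀ n x, Continuous fun t : ℝ≥0 => exp ((t : ℝ) • T n) x := by
    intro n x
    have : Continuous fun t : ℝ => exp (t • T n) :=
      (differentiable_exp_smul_const ℝ (T n)).continuous
    exact (this.comp NNReal.continuous_coe).clm_apply continuous_const
  have hcont0 : ∀ x ∈ A.domain, Continuous fun t => S t x := by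
    intro x hx
    have h1 : TendstoLocallyUniformly (fun (n : ℕ) (t : ℝ≥0) => exp ((t : ℝ) • T n) x)
        (fun t => S t x) atTop := by
      rw [tendstoLocallyUniformly_iff_forall_isCompact]
      intro K hK
      obtain ⟨C, hC⟩ := hK.bddAbove
      rw [Metric.tendstoUniformlyOn_iff]
      intro ε hε
      have h2 : Tendsto (fun n => M * (M * ‖A ⟨x, hx⟩ - T n x‖) * C) atTop (𝓝 0) := by
        have := (((hTA ⟨x, hx⟩).const_sub (A ⟨x, hx⟩)).norm.const_mul M).const_mul M
        have := this.mul_const (C : ℝ)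
        simpa using this
      filter_upwards [h2.eventually_lt_const hε] with n hn t ht
      rw [dist_eq_norm]
      refine (hdiff t ⟨x, hx⟩ n).trans_lt (lt_of_le_of_lt ?_ hn)
      have : t ≤ C := hC ht
      gcongr
    exact h1.continuous (Eventually.of_forall (hcontT · x)).frequently
  have hcont : ∀ x, Continuous fun t => S t x := by
    intro x
    rw [continuous_iff_continuousAt]
    intro t
    exact tendsto_apply_of_dense (Eventually.of_forall hSM) hD
      (fun z hz => (hcont0 z hz).continuousAt) x
  have hS0 : S 0 = ContinuousLinearMap.id ℂ X := by
    ext x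
    refine tendsto_nhds_unique (hS 0 x) ?_
    simp
  have hSadd : ∀ s t, S (s + t) = (S s).comp (S t) := by
    intro s t
    ext x
    refine tendsto_nhds_unique (hS (s + t) x) ?_
    have h1 : ∀ n, exp (((s + t : ℝ≥0) : ℝ) • T n) x
        = exp ((s : ℝ) • T n) (exp ((t : ℝ) • T n) x) := by
      intro n
      let _ : NormedAlgebra ℚ (X →L[ℂ] X) := NormedAlgebra.restrictScalars ℚ ℝ (X →L[ℂ] X)
      rw [NNReal.coe_add, add_smul, exp_add_of_commute]
      · rfl
      · exact ((Commute.refl (T n)).smul_left _).smul_right _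
    simp only [h1, ContinuousLinearMap.comp_apply]
    -- A product of strong limits: the uniform bound lets the inner argument be replaced by its
    -- limit.
    have h2 : Tendsto (fun n => exp ((s : ℝ) • T n) (exp ((t : ℝ) • T n) x - S t x)) atTop
        (𝓝 0) := by
      refine squeeze_zero_norm (fun n => ContinuousLinearMap.le_of_opNorm_le _ (hM n s s.2) _) ?_
      have := ((hS t x).sub_const (S t x)).norm.const_mul M
      simpa using this
    have h3 := h2.add (hS s (S t x))
    simpa using h3
  have hgen : ∀ x : A.domain,
      Tendsto (fun h : ℝ≥0 => (h : ℂ)⁻¹ • (S h x - x)) (𝓝[>] 0) (𝓝 (A x)) := by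
    intro x
    rw [Metric.tendsto_nhds]
    intro ε hε
    have h2 : Tendsto (fun n => M * (M * ‖A x - T n x‖)) atTop (𝓝 0) := by
      have := (((hTA x).const_sub (A x)).norm.const_mul M).const_mul M
      simpa using this
    -- After division by h the bound `hdiff` no longer depends on h, so n can be fixed before h
    -- tends to 0.
    obtain ⟨n, hn1, hn2⟩ := ((h2.eventually_lt_const (by positivity : 0 < ε / 3)).and
      (Metric.tendsto_nhds.1 (hTA x) (ε / 3) (by positivity))).exists
    filter_upwards [Metric.tendsto_nhds.1 (tendsto_exp_smul_sub_div (T n) x) (ε / 3)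
      (by positivity), self_mem_nhdsWithin] with h hh hpos
    have hpos' : (0 : ℝ) < h := hpos
    have h3 : dist ((h : ℂ)⁻¹ • (S h x - (x : X))) ((h : ℂ)⁻¹ • (exp ((h : ℝ) • T n) x - x))
        < ε / 3 := by
      rw [dist_eq_norm, ← smul_sub, sub_sub_sub_cancel_right, norm_smul, norm_inv]
      have h4 : ‖(h : ℂ)‖ = (h : ℝ) := by
        rw [show (h : ℂ) = ((h : ℝ) : ℂ) from rfl, Complex.norm_real, Real.norm_of_nonneg hpos'.le]
      rw [h4]
      refine lt_of_le_of_lt ?_ hn1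
      rw [inv_mul_le_iff₀ hpos', mul_comm (h : ℝ)]
      exact hdiff h x n
    linarith [dist_triangle4 ((h : ℂ)⁻¹ • (S h x - (x : X)))
      ((h : ℂ)⁻¹ • (exp ((h : ℝ) • T n) x - x)) (T n x) (A x)]
  have hRS : ∀ t x, R (S t x) = S t (R x) := by
    intro t x
    refine tendsto_nhds_unique ((R.continuous.tendsto _).comp (hS t x)) ?_
    refine (hS t (R x)).congr fun n => ?_
    have := (((hRT n).smul_right (t : ℝ)).exp_right).eq
    exact (congrArg (fun B : X →L[ℂ] X => B x) this).symm
  refine ⟨⟨S, hS0, hSadd, hcont⟩, fun x y => ⟨fun hxy => ?_, fun hxy => ?_⟩⟩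
  · rw [LinearPMap.mem_graph_iff] at hxy
    obtain ⟨z, rfl, rfl⟩ := hxy
    exact hgen z
  -- No proper extension of A can be the generator: applying R to the difference quotient of x moves
  -- it into the domain, so R y = A R x. Hence x = R (μx - y), which lies in the domain, and A x =
  -- y.
  · obtain ⟨hx, e⟩ := hR x
    have h1 : R y = A ⟨R x, hx⟩ := by
      refine tendsto_nhds_unique ((R.continuous.tendsto y).comp hxy) ?_
      refine (hgen ⟨R x, hx⟩).congr fun h => ?_
      simp [hRS]
    have h2 : x = R (μ • x - y) := by
      rw [map_sub, map_smul, h1, e]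
    obtain ⟨hz, e'⟩ := hR (μ • x - y)
    have h3 : μ • R (μ • x - y) = μ • x := by rw [← h2]
    rw [h3, sub_right_inj] at e'
    rw [LinearPMap.mem_graph_iff]
    exact ⟨⟨R (μ • x - y), hz⟩, h2.symm, e'⟩

end Semigroup

/-! ### Dissipative operators and the Lumer–Phillips theorem -/

section Dissipative

variable {H : Type*} [NormedAddCommGroup H] [InnerProductSpace ℂ H]

theorem re_inner_apply_comm {Q : H →L[ℂ] H} (hQ : (Q : H →ₗ[ℂ] H).IsSymmetric) (x y : H) :
    (inner ℂ x (Q y)).re = (inner ℂ y (Q x)).re := by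
  have h : inner ℂ (Q x) y = inner ℂ x (Q y) := hQ x y
  rw [← h, ← inner_conj_symm, Complex.conj_re]

theorem re_inner_apply_self_le (Q : H →L[ℂ] H) (x y : H) :
    (inner ℂ x (Q y)).re ≤ ‖Q‖ * ‖x‖ * ‖y‖ :=
  calc (inner ℂ x (Q y)).re ≤ ‖x‖ * ‖Q y‖ := re_inner_le_norm (𝕜 := ℂ) x (Q y)
    _ ≤ ‖x‖ * (‖Q‖ * ‖y‖) := by gcongr; exact Q.le_opNorm y
    _ = _ := by ring

variable {Q : H →L[ℂ] H} {q : ℝ}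

/-- Pairing μx - Ax with x in the weighted form gives qμ‖x‖² ≤ Re ⟨x, Q(μx - Ax)⟩, and
Cauchy–Schwarz finishes. This a priori bound gives both injectivity of μ - A and boundedness of the
resolvent. -/
theorem mul_norm_le_of_dissipative (hpos : ∀ x, q * ‖x‖ ^ 2 ≤ (inner ℂ x (Q x)).re) {A : H →ₗ.[ℂ] H}
    (hA : ∀ x : A.domain, (inner ℂ (x : H) (Q (A x))).re ≤ 0) {μ : ℝ} (hμ : 0 < μ)
    (x : A.domain) : q * μ * ‖(x : H)‖ ≤ ‖Q‖ * ‖(μ : ℂ) • (x : H) - A x‖ := by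
  rcases eq_or_ne (x : H) 0 with h0 | h0
  · rw [h0, norm_zero, mul_zero]; positivity
  have h1 : (inner ℂ (x : H) (Q ((μ : ℂ) • (x : H) - A x))).re
      = μ * (inner ℂ (x : H) (Q x)).re - (inner ℂ (x : H) (Q (A x))).re := by
    rw [map_sub, map_smul, inner_sub_right, inner_smul_right, Complex.sub_re,
      Complex.re_ofReal_mul]
  have h2 := re_inner_apply_self_le Q (x : H) ((μ : ℂ) • (x : H) - A x)
  have h3 := mul_le_mul_of_nonneg_left (hpos x) hμ.le
  have h4 := hA x
  have h5 : 0 < ‖(x : H)‖ := norm_pos_iff.2 h0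
  refine le_of_mul_le_mul_right ?_ h5
  nlinarith

theorem exists_resolvent_of_dissipative (hq : 0 < q)
    (hpos : ∀ x, q * ‖x‖ ^ 2 ≤ (inner ℂ x (Q x)).re) {A : H →ₗ.[ℂ] H}
    (hA : ∀ x : A.domain, (inner ℂ (x : H) (Q (A x))).re ≤ 0) {μ : ℝ} (hμ : 0 < μ)
    (hs : ∀ y, ∃ x : A.domain, (μ : ℂ) • (x : H) - A x = y) :
    ∃ R : H →L[ℂ] H, (∀ y, q * μ * ‖R y‖ ≤ ‖Q‖ * ‖y‖) ∧
      (∀ y, ∃ h : R y ∈ A.domain, (μ : ℂ) • R y - A ⟨R y, h⟩ = y) ∧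
      ∀ x : A.domain, R ((μ : ℂ) • (x : H) - A x) = x := by
  let L : A.domain →ₗ[ℂ] H := (μ : ℂ) • A.domain.subtype - A.toFun
  have hL : ∀ x, L x = (μ : ℂ) • (x : H) - A x := fun x => rfl
  have hinj : Function.Injective L := by
    rw [← LinearMap.ker_eq_bot, LinearMap.ker_eq_bot']
    intro x hx
    have := mul_norm_le_of_dissipative hpos hA hμ x
    rw [← hL, hx, norm_zero, mul_zero] at this
    have h0 : ‖(x : H)‖ ≤ 0 := by
      by_contra h
      have : 0 < q * μ * ‖(x : H)‖ := by have := not_le.1 h; positivity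
      linarith
    exact Subtype.ext (norm_le_zero_iff.1 h0)
  let e : A.domain ≃ₗ[ℂ] H := LinearEquiv.ofBijective L ⟨hinj, hs⟩
  have he : ∀ y, (μ : ℂ) • (e.symm y : H) - A (e.symm y) = y := fun y => by
    rw [← hL]; exact e.apply_symm_apply y
  have hb : ∀ y, q * μ * ‖(e.symm y : H)‖ ≤ ‖Q‖ * ‖y‖ := fun y => by
    have := mul_norm_le_of_dissipative hpos hA hμ (e.symm y)
    rwa [he] at this
  let R : H →L[ℂ] H := LinearMap.mkContinuous (A.domain.subtype ∘ₗ e.symm.toLinearMap)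
    (‖Q‖ / (q * μ)) fun y => by
      rw [div_mul_eq_mul_div, le_div_iff₀ (by positivity), mul_comm]
      exact hb y
  refine ⟨R, hb, fun y => ⟨(e.symm y).2, he y⟩, fun x => ?_⟩
  rw [← hL]
  exact congrArg Subtype.val (e.symm_apply_apply x)

variable [CompleteSpace H]

open NormedSpace in
-- The energy Re ⟨u, Qu⟩ decreases along u(s) = exp(sB) x. Comparing it with ‖u‖², from below by q
-- and from above by ‖Q‖, produces the constant, which is independent of B.
theorem norm_exp_smul_le_of_dissipative (hQ : (Q : H →ₗ[ℂ] H).IsSymmetric) (hq : 0 < q)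
    (hpos : ∀ x, q * ‖x‖ ^ 2 ≤ (inner ℂ x (Q x)).re) {B : H →L[ℂ] H}
    (hB : ∀ x, (inner ℂ x (Q (B x))).re ≤ 0) {t : ℝ} (ht : 0 ≤ t) :
    ‖exp (t • B)‖ ≤ √(‖Q‖ / q) := by
  refine ContinuousLinearMap.opNorm_le_bound _ (Real.sqrt_nonneg _) fun x => ?_
  let u : ℝ → H := fun s => exp (s • B) x
  have hu : ∀ s, HasDerivAt u (B (u s)) s := by
    intro s
    have := ((ContinuousLinearMap.apply ℂ H x).restrictScalars ℝ).hasFDerivAt.comp_hasDerivAt s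
      (hasDerivAt_exp_smul_const' (𝕂 := ℝ) B s)
    simpa [Function.comp_def, u] using this
  have hφ : ∀ s, HasDerivAt (fun s => (inner ℂ (u s) (Q (u s))).re)
      (2 * (inner ℂ (u s) (Q (B (u s)))).re) s := by
    intro s
    have h1 := (hu s).inner ℂ ((Q.restrictScalars ℝ).hasFDerivAt.comp_hasDerivAt s (hu s))
    have h2 := Complex.reCLM.hasFDerivAt.comp_hasDerivAt s h1
    refine h2.congr_deriv ?_
    simp only [Complex.reCLM_apply, Complex.add_re, ContinuousLinearMap.coe_restrictScalars',
      Function.comp_apply]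
    rw [re_inner_apply_comm hQ (B (u s)) (u s)]
    ring
  have hanti : Antitone fun s => (inner ℂ (u s) (Q (u s))).re :=
    antitone_of_deriv_nonpos (fun s => (hφ s).differentiableAt) fun s => by
      rw [(hφ s).deriv]
      linarith [hB (u s)]
  have h0 : u 0 = x := by simp [u]
  have h1 := hanti ht
  simp only [h0] at h1
  have h2 := re_inner_apply_self_le Q x x
  have h3 := hpos (u t)
  have h4 : ‖u t‖ ^ 2 ≤ ‖Q‖ / q * ‖x‖ ^ 2 := by
    rw [div_mul_eq_mul_div, le_div_iff₀ hq]
    nlinarith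
  calc ‖exp (t • B) x‖ = √(‖u t‖ ^ 2) := (Real.sqrt_sq (norm_nonneg _)).symm
    _ ≤ √(‖Q‖ / q * ‖x‖ ^ 2) := Real.sqrt_le_sqrt h4
    _ = _ := by rw [Real.sqrt_mul (by positivity), Real.sqrt_sq (norm_nonneg _)]

/-- The Lumer–Phillips theorem in a Hilbert space, for dissipativity with respect to the
equivalent inner product `⟪x, Q y⟫`. -/
theorem exists_C0Semigroup_of_dissipative (hQ : (Q : H →ₗ[ℂ] H).IsSymmetric) (hq : 0 < q)
    (hpos : ∀ x, q * ‖x‖ ^ 2 ≤ (inner ℂ x (Q x)).re) {A : H →ₗ.[ℂ] H}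
    (hA : ∀ x : A.domain, (inner ℂ (x : H) (Q (A x))).re ≤ 0)
    (hs : ∀ μ : ℝ, 0 < μ → ∀ y, ∃ x : A.domain, (μ : ℂ) • (x : H) - A x = y) :
    ∃ S : C0Semigroup H, S.IsGeneratedBy A := by
  choose! R hRb hRA hRL using fun (μ : ℝ) (hμ : 0 < μ) =>
    exists_resolvent_of_dissipative hq hpos hA hμ (hs μ hμ)
  have hpos' : ∀ x, x ≠ 0 → 0 < (inner ℂ x (Q x)).re := fun x hx =>
    lt_of_lt_of_le (by have := norm_pos_iff.2 hx; positivity) (hpos x)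
  -- Density is automatic. If x ⟂ D(A), write x = Q x' and r = R(1) x', so that x' = r - Ar. Then 0
  -- = ⟨r, Qx'⟩ forces Re ⟨r, QAr⟩ = Re ⟨r, Qr⟩, which is positive unless r = 0; but r = 0 means x =
  -- 0.
  have hD : Dense (A.domain : Set H) := by
    rw [Submodule.dense_iff_topologicalClosure_eq_top, Submodule.topologicalClosure_eq_top_iff,
      Submodule.eq_bot_iff]
    intro x hx
    have hu : IsUnit Q := by
      refine ContinuousLinearMap.isUnit_of_forall_le_norm_inner_map Q (c := ⟨q, hq.le⟩) hq
        fun y => ?_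
      rw [norm_inner_symm, mul_comm]
      exact (hpos y).trans (Complex.re_le_norm _)
    obtain ⟨Q', hQ'⟩ := hu.exists_right_inv
    have hQz : Q (Q' x) = x := congrArg (fun B : H →L[ℂ] H => B x) hQ'
    obtain ⟨h1, e1⟩ := hRA 1 one_pos (Q' x)
    by_contra hx0
    have hr : R 1 (Q' x) ≠ 0 := by
      intro h
      have h2 : (⟨R 1 (Q' x), h1⟩ : A.domain) = 0 := Subtype.ext h
      rw [h2, LinearPMap.map_zero, h, smul_zero, sub_zero] at e1
      rw [← hQz, ← e1, map_zero] at hx0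
      exact hx0 rfl
    have h2 : inner ℂ (R 1 (Q' x)) (Q (Q' x)) = 0 := by
      rw [hQz]
      exact hx _ h1
    have h4 : Q (Q' x) = Q (R 1 (Q' x)) - Q (A ⟨R 1 (Q' x), h1⟩) := by
      rw [Complex.ofReal_one, one_smul] at e1
      rw [← map_sub, e1]
    rw [h4, inner_sub_right, sub_eq_zero] at h2
    have h3 := hpos' _ hr
    rw [h2] at h3
    exact absurd (hA ⟨_, h1⟩) (not_le.2 h3)
  -- The resolvent identity. Comparing it with the version in which μ and ν are exchanged shows that
  -- resolvents commute.
  have hres : ∀ μ ν : ℝ, 0 < μ → 0 < ν → ∀ x,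
      R μ x = R ν x + ((ν : ℂ) - μ) • R ν (R μ x) := by
    intro μ ν hμ hν x
    obtain ⟨h1, e1⟩ := hRA μ hμ x
    have h2 := hRL ν hν ⟨R μ x, h1⟩
    have h3 : (ν : ℂ) • R μ x - A ⟨R μ x, h1⟩ = x + ((ν : ℂ) - μ) • R μ x := by
      nth_rewrite 3 [← e1]
      module
    rw [h3, map_add, map_smul] at h2
    exact h2.symm
  have hcomm : ∀ μ ν : ℝ, 0 < μ → 0 < ν → Commute (R μ) (R ν) := by
    intro μ ν hμ hν
    rcases eq_or_ne μ ν with rfl | hne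
    · exact Commute.refl _
    ext x
    have h1 := hres μ ν hμ hν x
    have h2 := hres ν μ hν hμ x
    have h3 : ((ν : ℂ) - μ) • (R μ (R ν x)) = ((ν : ℂ) - μ) • R ν (R μ x) := by
      have h4 : R ν x = R μ x - ((ν : ℂ) - μ) • R μ (R ν x) := by
        rw [eq_sub_iff_add_eq]
        nth_rewrite 1 [h2]
        module
      rw [h4, eq_comm, ← sub_eq_zero] at h1
      rw [← sub_eq_zero, ← neg_eq_zero, ← h1]
      abel
    exact smul_right_injective H (sub_ne_zero.2 (by exact_mod_cast hne.symm)) h3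
  let k : ℕ → ℝ := fun n => (n : ℝ) + 1
  have hk : ∀ n, 0 < k n := fun n => by positivity
  -- On the domain k R(k) y = y + R(k) A y, and R(k) = O(1/k). The norms ‖k R(k)‖ are bounded by
  -- ‖Q‖/q, so density does the rest.
  have hJ : ∀ y, Tendsto (fun n : ℕ => ((k n : ℂ) • R (k n)) y) atTop (𝓝 y) := by
    refine tendsto_apply_of_dense (T' := ContinuousLinearMap.id ℂ H) (M := ‖Q‖ / q)
      (Eventually.of_forall fun n => ?_) hD fun y hy => ?_
    · refine ContinuousLinearMap.opNorm_le_bound _ (by positivity) fun y => ?_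
      have := hRb (k n) (hk n) y
      rw [smul_apply, norm_smul, Complex.norm_real,
        Real.norm_of_nonneg (hk n).le, div_mul_eq_mul_div, le_div_iff₀ hq]
      linarith
    · have h1 : ∀ n, ((k n : ℂ) • R (k n)) y = y + R (k n) (A ⟨y, hy⟩) := by
        intro n
        have := hRL (k n) (hk n) ⟨y, hy⟩
        rw [map_sub, map_smul, sub_eq_iff_eq_add] at this
        exact this
      simp only [h1, ContinuousLinearMap.id_apply]
      have h2 : Tendsto (fun n => R (k n) (A ⟨y, hy⟩)) atTop (𝓝 0) := by
        refine squeeze_zero_norm (a := fun n : ℕ => ‖Q‖ * ‖A ⟨y, hy⟩‖ / q * (1 / ((n : ℝ) + 1)))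
          (fun n => ?_) ?_
        · have := hRb (k n) (hk n) (A ⟨y, hy⟩)
          rw [div_mul_div_comm, mul_one, le_div_iff₀ (mul_pos hq (hk n)), mul_comm]
          exact this
        · simpa using (tendsto_one_div_add_atTop_nhds_zero_nat (𝕜 := ℝ)).const_mul
            (‖Q‖ * ‖A ⟨y, hy⟩‖ / q)
      simpa using h2.const_add y
  -- The Yosida approximation k A R(k), written without A so that it is visibly bounded and commutes
  -- with the resolvents.
  let T : ℕ → H →L[ℂ] H := fun n => (k n : ℂ) • ((k n : ℂ) • R (k n) - 1)
  have hRT : ∀ μ n, 0 < μ → Commute (R μ) (T n) := fun μ n hμ =>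
    ((((hcomm _ _ hμ (hk n)).smul_right _).sub_right (Commute.one_right _))).smul_right _
  refine exists_C0Semigroup_of_approx A hD T (fun m n => ?_) (M := √(‖Q‖ / q))
    (fun n t ht => norm_exp_smul_le_of_dissipative hQ hq hpos (fun x => ?_) ht) (fun x => ?_)
    ((1 : ℝ) : ℂ) (R 1) (hRA 1 one_pos) (fun n => hRT 1 n one_pos)
  · exact (((hRT (k m) n (hk m)).smul_left _).sub_left (Commute.one_left _)).smul_left _
  -- With r = R(k) x one has x = kr - Ar and T x = k Ar. Hence Re ⟨x, QTx⟩ = k (k Re ⟨r, QAr⟩ - Re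
  -- ⟨Ar, QAr⟩), and both terms are nonpositive.
  · obtain ⟨h1, e1⟩ := hRA (k n) (hk n) x
    have h2 : T n x = (k n : ℂ) • A ⟨R (k n) x, h1⟩ := by
      simp only [T, smul_apply, sub_apply,
        one_apply_eq_self]
      congr 1
      rw [sub_eq_iff_eq_add, ← sub_eq_iff_eq_add', e1]
    have h3 := hA ⟨R (k n) x, h1⟩
    rw [h2, map_smul, inner_smul_right, Complex.re_ofReal_mul]
    refine mul_nonpos_of_nonneg_of_nonpos (hk n).le ?_
    nth_rewrite 1 [← e1]
    rw [inner_sub_left, inner_smul_left, Complex.conj_ofReal, Complex.sub_re,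
      Complex.re_ofReal_mul]
    have h4 := mul_nonpos_of_nonneg_of_nonpos (hk n).le h3
    have h5 := hpos (A ⟨R (k n) x, h1⟩)
    have : 0 ≤ q * ‖A ⟨R (k n) x, h1⟩‖ ^ 2 := by positivity
    linarith
  · refine (hJ (A x)).congr fun n => ?_
    have := hRL (k n) (hk n) x
    rw [map_sub, map_smul, sub_eq_iff_eq_add, ← sub_eq_iff_eq_add'] at this
    simp only [T, smul_apply, sub_apply,
      one_apply_eq_self, this]

/-- The new semigroup is e^{κt} S(t). The product rule splits its difference quotient, and since
e^{κt} is invertible and tends to 1, convergence of either quotient implies that of the other. -/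
theorem C0Semigroup.isGeneratedBy_rescale {X : Type*} [NormedAddCommGroup X] [NormedSpace ℂ X]
    {A B : X →ₗ.[ℂ] X} {κ : ℝ}
    (hAB : ∀ x y, (x, y) ∈ A.graph ↔ (x, y - (κ : ℂ) • x) ∈ B.graph)
    {S : C0Semigroup X} (hS : S.IsGeneratedBy B) :
    ∃ S' : C0Semigroup X, S'.IsGeneratedBy A := by
  let a : ℝ≥0 → ℂ := fun t => Complex.exp (κ * t)
  have ha : Continuous a := by fun_prop
  have ha0 : a 0 = 1 := by simp [a]
  have haT : Tendsto a (𝓝[>] 0) (𝓝 1) := by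
    rw [← ha0]; exact (ha.tendsto 0).mono_left nhdsWithin_le_nhds
  have had : Tendsto (fun h : ℝ≥0 => (h : ℂ)⁻¹ * (a h - 1)) (𝓝[>] 0) (𝓝 κ) := by
    have h1 : HasDerivAt (fun t : ℝ => Complex.exp (κ * t)) κ 0 := by
      have := ((hasDerivAt_id (0 : ℝ)).ofReal_comp.const_mul (κ : ℂ)).cexp
      simpa using this
    have h3 := h1.tendsto_slope_zero_right
    have h4 : Tendsto (fun h : ℝ≥0 => (h : ℝ)) (𝓝[>] 0) (𝓝[>] 0) := by
      refine tendsto_nhdsWithin_iff.2 ⟨?_, ?_⟩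
      · exact (NNReal.continuous_coe.tendsto 0).mono_left nhdsWithin_le_nhds
      · filter_upwards [self_mem_nhdsWithin] with h hh
        exact NNReal.coe_pos.2 hh
    refine (h3.comp h4).congr fun h => ?_
    simp [a]
  have hsplit : ∀ (h : ℝ≥0) (x : X), (h : ℂ)⁻¹ • (a h • S.S h x - x)
      = a h • ((h : ℂ)⁻¹ • (S.S h x - x)) + ((h : ℂ)⁻¹ * (a h - 1)) • x := fun h x => by module
  refine ⟨⟨fun t => a t • S.S t, ?_, fun s t => ?_, fun x => ?_⟩, fun x y => ?_⟩
  · rw [ha0, one_smul, S.map_zero]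
  · rw [S.map_add]
    ext x
    simp only [a, smul_apply, ContinuousLinearMap.comp_apply, map_smul,
      smul_smul, NNReal.coe_add, Complex.ofReal_add, mul_add, Complex.exp_add]
    rw [mul_comm]
  · exact ha.smul (S.continuous_orbit x)
  · rw [hAB, hS x]
    constructor
    · intro h
      have := (haT.smul h).add (had.smul_const x)
      rw [one_smul, sub_add_cancel] at this
      exact this.congr fun t => (hsplit t x).symm
    · intro h
      have hai : Tendsto (fun t => (a t)⁻¹) (𝓝[>] 0) (𝓝 1) := by
        simpa using haT.inv₀ one_ne_zero
      rw [← one_smul ℂ (y - (κ : ℂ) • x)]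
      refine (hai.smul (h.sub (had.smul_const x))).congr fun t => ?_
      have e : a t ≠ 0 := Complex.exp_ne_zero _
      rw [smul_apply, hsplit, add_sub_cancel_right, smul_smul,
        inv_mul_cancel₀ e, one_smul]

/-- The Lumer–Phillips theorem for quasi-dissipative operators. -/
theorem exists_C0Semigroup_of_quasiDissipative (hQ : (Q : H →ₗ[ℂ] H).IsSymmetric) (hq : 0 < q)
    (hpos : ∀ x, q * ‖x‖ ^ 2 ≤ (inner ℂ x (Q x)).re) {A : H →ₗ.[ℂ] H} {κ : ℝ}
    (hA : ∀ x : A.domain, (inner ℂ (x : H) (Q (A x))).re ≤ κ * (inner ℂ (x : H) (Q x)).re)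
    (hs : ∀ μ : ℝ, κ < μ → ∀ y, ∃ x : A.domain, (μ : ℂ) • (x : H) - A x = y) :
    ∃ S : C0Semigroup H, S.IsGeneratedBy A := by
  let B : H →ₗ.[ℂ] H := ⟨A.domain, A.toFun - (κ : ℂ) • A.domain.subtype⟩
  have hB : ∀ x : A.domain, B x = A x - (κ : ℂ) • (x : H) := fun x => rfl
  obtain ⟨S, hS⟩ := exists_C0Semigroup_of_dissipative (A := B) hQ hq hpos
    (fun x => by
      rw [hB, map_sub, map_smul, inner_sub_right, inner_smul_right, Complex.sub_re,
        Complex.re_ofReal_mul]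
      linarith [hA x])
    (fun μ hμ y => by
      obtain ⟨x, hx⟩ := hs (μ + κ) (by linarith) y
      refine ⟨x, ?_⟩
      rw [hB, ← hx, Complex.ofReal_add]
      module)
  refine C0Semigroup.isGeneratedBy_rescale (κ := κ) (fun x y => ?_) hS
  simp only [LinearPMap.mem_graph_iff]
  constructor
  · rintro ⟨z, rfl, rfl⟩
    exact ⟨z, rfl, hB z⟩
  · rintro ⟨z, rfl, h⟩
    refine ⟨z, rfl, ?_⟩
    rw [hB z] at h
    exact sub_left_injective h

end Dissipative

/-! ### Multiplication by matrix-valued functions -/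

section Matrices

theorem norm_toEuclideanLin_apply_le {n : ℕ} (A : Matrix (Fin n) (Fin n) ℂ)
    (ξ : EuclideanSpace ℂ (Fin n)) :
    ‖Matrix.toEuclideanLin A ξ‖ ≤ (∑ i, ∑ j, ‖A i j‖) * ‖ξ‖ := by
  have e : Matrix.toEuclideanLin A ξ
      = ∑ i, ∑ j, (A i j * ξ j) • EuclideanSpace.single i (1 : ℂ) := by
    ext k
    simp only [WithLp.ofLp_sum, Finset.sum_apply, PiLp.smul_apply, smul_eq_mul, PiLp.single_apply,
      Matrix.toLpLin_apply, Matrix.mulVec, dotProduct]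
    symm
    rw [Finset.sum_eq_single k]
    · simp
    · intro b _ hb
      simp [Ne.symm hb]
    · simp
  rw [e, Finset.sum_mul]
  refine (norm_sum_le _ _).trans (Finset.sum_le_sum fun i _ => ?_)
  rw [Finset.sum_mul]
  refine (norm_sum_le _ _).trans (Finset.sum_le_sum fun j _ => ?_)
  rw [norm_smul, norm_mul, PiLp.norm_single, norm_one, mul_one]
  gcongr
  exact PiLp.norm_apply_le ξ j

variable {ℓ : ℝ} {n : ℕ}

theorem matrixMul_ae {F : ℝ → Matrix (Fin n) (Fin n) ℂ}
    (hF : ∀ i j, MemLp (fun x => F x i j) ∞ (volume.restrict (Ioo (0 : ℝ) ℓ))) (u : EdgeL2 ℓ n) :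
    ∀ᵐ x ∂(volume.restrict (Ioo 0 ℓ)), matrixMul F hF u x = Matrix.toEuclideanLin (F x) (u x) :=
  MemLp.coeFn_toLp (memLp_mulVec hF u)

/-- The bound is pointwise almost everywhere, not merely in L²: the Volterra iteration needs to
control the integrand at each point. -/
theorem exists_matrixMul_bound {F : ℝ → Matrix (Fin n) (Fin n) ℂ}
    (hF : ∀ i j, MemLp (fun x => F x i j) ∞ (volume.restrict (Ioo (0 : ℝ) ℓ))) :
    ∃ C, 0 ≤ C ∧ ∀ u : EdgeL2 ℓ n,
      ∀ᵐ x ∂(volume.restrict (Ioo 0 ℓ)), ‖matrixMul F hF u x‖ ≤ C * ‖u x‖ := by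
  have h : ∀ i j, ∀ᵐ x ∂(volume.restrict (Ioo 0 ℓ)), ‖F x i j‖
      ≤ (eLpNorm (fun x => F x i j) ∞ (volume.restrict (Ioo (0 : ℝ) ℓ))).toReal := by
    intro i j
    filter_upwards [ae_le_eLpNormEssSup (f := fun x => F x i j)
      (μ := volume.restrict (Ioo (0 : ℝ) ℓ))] with x hx
    rw [← toReal_enorm, eLpNorm_exponent_top]
    refine ENNReal.toReal_mono ?_ hx
    rw [← eLpNorm_exponent_top]
    exact (hF i j).2.ne
  refine ⟨∑ i, ∑ j, (eLpNorm (fun x => F x i j) ∞ (volume.restrict (Ioo (0 : ℝ) ℓ))).toReal,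
    Finset.sum_nonneg fun i _ => Finset.sum_nonneg fun j _ => ENNReal.toReal_nonneg, fun u => ?_⟩
  filter_upwards [matrixMul_ae hF u, ae_all_iff.2 fun i => ae_all_iff.2 (h i)] with x hx hb
  rw [hx]
  refine (norm_toEuclideanLin_apply_le _ _).trans ?_
  gcongr
  exact hb _ _

theorem memLp_top_of_continuousOn {f : ℝ → ℂ} (hc : ContinuousOn f (Icc 0 ℓ)) :
    MemLp f ∞ (volume.restrict (Ioo (0 : ℝ) ℓ)) := by
  obtain ⟨C, hC⟩ := isCompact_Icc.exists_bound_of_continuousOn hc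
  refine memLp_top_of_bound ((hc.mono Ioo_subset_Icc_self).aestronglyMeasurable
    measurableSet_Ioo) C ?_
  filter_upwards [ae_restrict_mem measurableSet_Ioo] with x hx
  exact hC x (Ioo_subset_Icc_self hx)

theorem continuousOn_matrix_inv_apply {s : Set ℝ} {F : ℝ → Matrix (Fin n) (Fin n) ℂ}
    (hF : ∀ i j, ContinuousOn (fun x => F x i j) s) (hu : ∀ x ∈ s, IsUnit (F x)) (i j : Fin n) :
    ContinuousOn (fun x => (F x)⁻¹ i j) s := by
  rw [continuousOn_iff_continuous_domRestrict]
  have h : Continuous fun x : s => F x := by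
    refine continuous_matrix fun i j => ?_
    exact continuousOn_iff_continuous_domRestrict.1 (hF i j)
  have h2 : Continuous fun x : s => ((F x).det)⁻¹ :=
    h.matrix_det.inv₀ fun x => ((Matrix.isUnit_iff_isUnit_det _).1 (hu x x.2)).ne_zero
  have h3 : Continuous fun x : s => ((F x).det)⁻¹ * (F x).adjugate i j :=
    h2.mul (h.matrix_adjugate.matrix_elem i j)
  refine h3.congr fun x => ?_
  simp [Matrix.inv_def, Ring.inverse_eq_inv']

end Matrices

/-! ### H¹ functions as primitives of their weak derivatives -/

section Sobolev

variable {ℓ : ℝ} {n : ℕ}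

theorem EdgeL2.intervalIntegrable (hℓ : 0 < ℓ) (g : EdgeL2 ℓ n) {a b : ℝ} (ha : a ∈ Icc 0 ℓ)
    (hb : b ∈ Icc 0 ℓ) : IntervalIntegrable g volume a b := by
  have h1 : IntervalIntegrable g volume 0 ℓ := by
    rw [intervalIntegrable_iff_integrableOn_Ioo_of_le hℓ.le]
    exact g.integrable
  refine h1.mono_set ?_
  rw [uIcc_of_le hℓ.le]
  exact uIcc_subset_Icc ha hb

theorem setIntegral_restrict_Ioo_eq {F : Type*} [NormedAddCommGroup F] [NormedSpace ℝ F]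
    (g : ℝ → F) {x : ℝ} (hx : x ∈ Icc 0 ℓ) :
    ∫ t in Ioc 0 x, g t ∂(volume.restrict (Ioo 0 ℓ)) = ∫ t in 0..x, g t := by
  rw [intervalIntegral.integral_of_le hx.1, Measure.restrict_restrict measurableSet_Ioc]
  refine setIntegral_congr_set ?_
  have h : (Ioc 0 x ∩ Ioo 0 ℓ : Set ℝ) =ᵐ[volume] (Ioc 0 x ∩ Ioc 0 ℓ : Set ℝ) :=
    ae_eq_set_inter (ae_eq_refl _) Ioo_ae_eq_Ioc
  rwa [inter_eq_left.2 (Ioc_subset_Ioc_right hx.2)] at h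

theorem continuousOn_primitive_edgeL2 (hℓ : 0 < ℓ) (g : EdgeL2 ℓ n) :
    ContinuousOn (fun x => ∫ t in 0..x, g t) (Icc 0 ℓ) := by
  have := intervalIntegral.continuousOn_primitive_interval' (a := 0)
    (g.intervalIntegrable hℓ (left_mem_Icc.2 hℓ.le) (right_mem_Icc.2 hℓ.le)) left_mem_uIcc
  rwa [uIcc_of_le hℓ.le] at this

/-- Test functions integrate by parts against the primitive by Fubini, and the constant drops out
because φ' has integral 0. -/
theorem hasWeakDeriv_of_ae_eq {u g : EdgeL2 ℓ n} {c : EuclideanSpace ℂ (Fin n)}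
    (h : ∀ᵐ x ∂(volume.restrict (Ioo 0 ℓ)), u x = c + ∫ t in 0..x, g t) :
    HasWeakDeriv u g := by
  intro φ hφ hc hs
  have hd : Continuous (deriv φ) := hφ.continuous_deriv (by norm_num)
  have hdi : Integrable (deriv φ) (volume.restrict (Ioo 0 ℓ)) :=
    (hd.integrable_of_hasCompactSupport hc.deriv).restrict
  have h0 : ∫ x in Ioo 0 ℓ, deriv φ x = 0 := by
    rw [setIntegral_eq_integral_of_forall_compl_eq_zero]
    · exact integral_eq_zero_of_hasDerivAt_of_integrable
        (fun x => (hφ.differentiable (by norm_num)).differentiableAt.hasDerivAt)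
        (hd.integrable_of_hasCompactSupport hc.deriv)
        (hφ.continuous.integrable_of_hasCompactSupport hc)
    · intro x hx
      by_contra h'
      exact hx (hs (support_deriv_subset h'))
  rw [← integral_deriv_smul_primitive g g.integrable φ hφ hc hs]
  have h1 : ∀ᵐ x ∂(volume.restrict (Ioo 0 ℓ)), deriv φ x • u x = deriv φ x • c
      + deriv φ x • ∫ t in Ioc 0 x, g t ∂(volume.restrict (Ioo 0 ℓ)) := by
    filter_upwards [h, ae_restrict_mem measurableSet_Ioo] with x hx hx'
    rw [hx, smul_add, setIntegral_restrict_Ioo_eq _ (Ioo_subset_Icc_self hx')]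
  have h2 : Integrable (fun x => deriv φ x • c) (volume.restrict (Ioo 0 ℓ)) :=
    hdi.smul_const c
  have h3 : Integrable (fun x => deriv φ x • ∫ t in Ioc 0 x, g t ∂(volume.restrict (Ioo 0 ℓ)))
      (volume.restrict (Ioo 0 ℓ)) := by
    refine ((u.integrable_smul hd hc.deriv).sub h2).congr ?_
    filter_upwards [h1] with x hx
    simp [hx]
  rw [integral_congr_ae h1, integral_add h2 h3, integral_smul_const, h0, zero_smul, zero_add]

/-- The difference of u and the primitive of g has weak derivative 0, hence is constant by the du
Bois-Reymond lemma. -/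
theorem exists_ae_eq_primitive (hℓ : 0 < ℓ) {u g : EdgeL2 ℓ n} (h : HasWeakDeriv u g) :
    ∃ c : EuclideanSpace ℂ (Fin n),
      ∀ᵐ x ∂(volume.restrict (Ioo 0 ℓ)), u x = c + ∫ t in 0..x, g t := by
  have hGi : Integrable (fun x => ∫ t in Ioc 0 x, g t ∂(volume.restrict (Ioo 0 ℓ)))
      (volume.restrict (Ioo 0 ℓ)) :=
    ((intervalIntegral.continuousOn_primitive g.integrable.integrableOn).integrableOn_compact
      isCompact_Icc).mono_set Ioo_subset_Icc_self
  obtain ⟨c, hc⟩ := ae_eq_const_of_integral_deriv_smul hℓ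
    (fun x => u x - ∫ t in Ioc 0 x, g t ∂(volume.restrict (Ioo 0 ℓ)))
    (u.integrable.sub hGi) (by
      intro φ hφ hφc hφs
      have hd : Continuous (deriv φ) := hφ.continuous_deriv (by norm_num)
      obtain ⟨C, hC⟩ := hd.bounded_above_of_compact_support hφc.deriv
      simp only [smul_sub]
      have hi : Integrable (fun x => deriv φ x •
          ∫ t in Ioc 0 x, g t ∂(volume.restrict (Ioo 0 ℓ))) (volume.restrict (Ioo 0 ℓ)) :=
        hGi.bdd_smul C hd.aestronglyMeasurable (Eventually.of_forall hC)
      rw [integral_sub (u.integrable_smul hd hφc.deriv) hi, h φ hφ hφc hφs,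
        integral_deriv_smul_primitive g g.integrable φ hφ hφc hφs, sub_self])
  refine ⟨c, ?_⟩
  filter_upwards [hc, ae_restrict_mem measurableSet_Ioo] with x hx hx'
  rw [← hx, ← setIntegral_restrict_Ioo_eq _ (Ioo_subset_Icc_self hx')]
  abel

theorem hasWeakDeriv_weakDeriv (u : EdgeH1 ℓ n) : HasWeakDeriv u (weakDeriv u) :=
  u.2.choose_spec

theorem pointValue_eq_of_ae_eq (hℓ : 0 < ℓ) (u : EdgeH1 ℓ n)
    {f : ℝ → EuclideanSpace ℂ (Fin n)} (hf : ContinuousOn f (Icc 0 ℓ))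
    (h : ∀ᵐ x ∂(volume.restrict (Ioo 0 ℓ)), (u : EdgeL2 ℓ n) x = f x) (a : Icc (0 : ℝ) ℓ) :
    pointValue hℓ a u = f a := by
  obtain ⟨h1, h2⟩ := (exists_rep_of_edgeH1 hℓ u).choose_spec
  refine eqOn_of_ae_eq hℓ h1 hf ?_ a.2
  filter_upwards [h, h2] with x hx hx'
  rw [← hx, hx']

theorem exists_eq_primitive (hℓ : 0 < ℓ) (u : EdgeH1 ℓ n) :
    ∃ c : EuclideanSpace ℂ (Fin n),
      (∀ᵐ x ∂(volume.restrict (Ioo 0 ℓ)), (u : EdgeL2 ℓ n) x = c + ∫ t in 0..x, weakDeriv u t) ∧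
      ∀ a : Icc (0 : ℝ) ℓ, pointValue hℓ a u = c + ∫ t in 0..(a : ℝ), weakDeriv u t := by
  obtain ⟨c, hc⟩ := exists_ae_eq_primitive hℓ (hasWeakDeriv_weakDeriv u)
  exact ⟨c, hc, pointValue_eq_of_ae_eq hℓ u
    (continuousOn_const.add (continuousOn_primitive_edgeL2 hℓ _)) hc⟩

end Sobolev

/-! ### Linear initial value problems on an edge -/

section Volterra

/-- (1 - L)(1 + L + ⋯ + L^{m-1}) = 1 - L^m is invertible by the Neumann series, so 1 - L has a right
inverse even when ‖L‖ is large. -/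
theorem exists_eq_add_apply_of_norm_pow_lt_one {X : Type*} [NormedAddCommGroup X]
    [NormedSpace ℂ X] [CompleteSpace X] {L : X →L[ℂ] X} {m : ℕ} (hm : ‖L ^ m‖ < 1) (h : X) :
    ∃ v, v = h + L v := by
  obtain ⟨U, hU⟩ := isUnit_one_sub_of_norm_lt_one hm
  refine ⟨((∑ i ∈ Finset.range m, L ^ i) * (↑U⁻¹ : X →L[ℂ] X)) h, ?_⟩
  have h1 : (1 - L) * ((∑ i ∈ Finset.range m, L ^ i) * (↑U⁻¹ : X →L[ℂ] X)) = 1 := by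
    rw [← mul_assoc, mul_neg_geom_sum, ← hU, Units.mul_inv]
  have h2 := congrArg (fun B : X →L[ℂ] X => B h) h1
  simp only [sub_mul, one_mul] at h2
  exact sub_eq_iff_eq_add.1 h2

variable {ℓ : ℝ} {n : ℕ}

theorem memLp_IccExtend (hℓ : 0 ≤ ℓ) (v : C(Icc (0 : ℝ) ℓ, EuclideanSpace ℂ (Fin n))) :
    MemLp (IccExtend hℓ v) 2 (volume.restrict (Ioo 0 ℓ)) :=
  MemLp.of_bound (v.continuous.Icc_extend' (h := hℓ)).aestronglyMeasurable ‖v‖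
    (Eventually.of_forall fun _ => v.norm_coe_le_norm _)

/-- A continuous function on `[0, ℓ]` as an element of `L²(0, ℓ)ⁿ`. -/
noncomputable def toEdgeL2 (hℓ : 0 ≤ ℓ) :
    C(Icc (0 : ℝ) ℓ, EuclideanSpace ℂ (Fin n)) →ₗ[ℂ] EdgeL2 ℓ n where
  toFun v := (memLp_IccExtend hℓ v).toLp _
  map_add' v w := by
    rw [← MemLp.toLp_add]; rfl
  map_smul' c v := by
    rw [RingHom.id_apply, ← MemLp.toLp_const_smul]; rfl

theorem toEdgeL2_ae (hℓ : 0 ≤ ℓ) (v : C(Icc (0 : ℝ) ℓ, EuclideanSpace ℂ (Fin n))) :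
    ∀ᵐ x ∂(volume.restrict (Ioo 0 ℓ)), toEdgeL2 hℓ v x = v (projIcc 0 ℓ hℓ x) :=
  MemLp.coeFn_toLp (memLp_IccExtend hℓ v)

/-- The primitive `g ↦ ∫₀ˣ g` of a function in `L²(0, ℓ)ⁿ`. -/
noncomputable def primitive (hℓ : 0 < ℓ) :
    EdgeL2 ℓ n →ₗ[ℂ] C(Icc (0 : ℝ) ℓ, EuclideanSpace ℂ (Fin n)) where
  toFun g := ⟨fun x => ∫ t in 0..(x : ℝ), g t,
    continuousOn_iff_continuous_domRestrict.1 (continuousOn_primitive_edgeL2 hℓ g)⟩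
  map_add' g g' := by
    ext1 x
    change ∫ t in 0..(x : ℝ), (g + g' : EdgeL2 ℓ n) t
      = (∫ t in 0..(x : ℝ), g t) + ∫ t in 0..(x : ℝ), g' t
    have h0 := left_mem_Icc.2 hℓ.le
    rw [← intervalIntegral.integral_add (g.intervalIntegrable hℓ h0 x.2)
      (g'.intervalIntegrable hℓ h0 x.2), ← setIntegral_restrict_Ioo_eq _ x.2,
      ← setIntegral_restrict_Ioo_eq _ x.2]
    exact integral_congr_ae (ae_restrict_of_ae (Lp.coeFn_add g g'))
  map_smul' c g := by
    ext1 x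
    change ∫ t in 0..(x : ℝ), (c • g : EdgeL2 ℓ n) t = c • ∫ t in 0..(x : ℝ), g t
    rw [← intervalIntegral.integral_smul, ← setIntegral_restrict_Ioo_eq _ x.2,
      ← setIntegral_restrict_Ioo_eq _ x.2]
    exact integral_congr_ae (ae_restrict_of_ae (Lp.coeFn_smul c g))

theorem primitive_apply (hℓ : 0 < ℓ) (g : EdgeL2 ℓ n) (x : Icc (0 : ℝ) ℓ) :
    primitive hℓ g x = ∫ t in 0..(x : ℝ), g t := rfl

/-- One step of the Volterra iteration: integration raises the power of x by one and divides by it,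
which is the source of the factorial. -/
theorem norm_primitive_apply_le (hℓ : 0 < ℓ) {K : EdgeL2 ℓ n →ₗ[ℂ] EdgeL2 ℓ n} {C : ℝ}
    (hC : 0 ≤ C)
    (hK : ∀ u : EdgeL2 ℓ n, ∀ᵐ x ∂(volume.restrict (Ioo 0 ℓ)), ‖K u x‖ ≤ C * ‖u x‖)
    {v : C(Icc (0 : ℝ) ℓ, EuclideanSpace ℂ (Fin n))} {B : ℝ} (m : ℕ)
    (hv : ∀ x, ‖v x‖ ≤ B * (x : ℝ) ^ m) (x : Icc (0 : ℝ) ℓ) :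
    ‖primitive hℓ (K (toEdgeL2 hℓ.le v)) x‖ ≤ C * B / (m + 1) * (x : ℝ) ^ (m + 1) := by
  have h1 : ∀ᵐ t, t ∈ Ioc 0 (x : ℝ) → ‖K (toEdgeL2 hℓ.le v) t‖ ≤ C * B * t ^ m := by
    have h2 : ∀ᵐ t ∂(volume.restrict (Ioo 0 ℓ)),
        ‖K (toEdgeL2 hℓ.le v) t‖ ≤ C * B * t ^ m := by
      filter_upwards [hK (toEdgeL2 hℓ.le v), toEdgeL2_ae hℓ.le v,
        ae_restrict_mem measurableSet_Ioo] with t ht ht' ht''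
      rw [ht', projIcc_of_mem _ (Ioo_subset_Icc_self ht'')] at ht
      refine ht.trans ?_
      rw [mul_assoc]
      gcongr
      exact hv ⟨t, _⟩
    -- For x = ℓ the half-open interval contains ℓ, where the bound on the open interval says
    -- nothing.
    have h3 : ∀ᵐ t : ℝ, t ≠ ℓ := by simp [ae_iff, measure_singleton]
    filter_upwards [(ae_restrict_iff' measurableSet_Ioo).1 h2, h3] with t ht hne ht'
    exact ht ⟨ht'.1, (ht'.2.trans x.2.2).lt_of_ne hne⟩
  rw [primitive_apply]
  refine (intervalIntegral.norm_integral_le_of_norm_le x.2.1 h1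
    (Continuous.intervalIntegrable (by fun_prop) _ _)).trans (le_of_eq ?_)
  rw [intervalIntegral.integral_const_mul, integral_pow]
  simp
  ring

/-- The problem is the fixed point equation v = c + ∫f + Lv in the continuous functions, with Lv =
∫Kv. Since ‖L^m‖ ≤ (Cℓ)^m / m! tends to 0, it is solvable with no smallness assumption on C or ℓ. -/
theorem exists_edgeH1_of_weakDeriv_eq (hℓ : 0 < ℓ) {K : EdgeL2 ℓ n →ₗ[ℂ] EdgeL2 ℓ n} {C : ℝ}
    (hC : 0 ≤ C)
    (hK : ∀ u : EdgeL2 ℓ n, ∀ᵐ x ∂(volume.restrict (Ioo 0 ℓ)), ‖K u x‖ ≤ C * ‖u x‖)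
    (f : EdgeL2 ℓ n) (c : EuclideanSpace ℂ (Fin n)) :
    ∃ u : EdgeH1 ℓ n, weakDeriv u = K u + f ∧
      pointValue hℓ ⟨0, left_mem_Icc.2 hℓ.le⟩ u = c := by
  let L : C(Icc (0 : ℝ) ℓ, EuclideanSpace ℂ (Fin n)) →L[ℂ]
      C(Icc (0 : ℝ) ℓ, EuclideanSpace ℂ (Fin n)) :=
    LinearMap.mkContinuous (primitive hℓ ∘ₗ K ∘ₗ toEdgeL2 hℓ.le) (C * ℓ) fun v => by
      rw [ContinuousMap.norm_le _ (by positivity)]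
      intro x
      refine (norm_primitive_apply_le hℓ hC hK (B := ‖v‖) 0 (fun x => ?_) x).trans ?_
      · simpa using v.norm_coe_le_norm x
      · have := mul_le_mul_of_nonneg_left x.2.2 (mul_nonneg hC (norm_nonneg v))
        simp
        linarith
  have hL : ∀ v, L v = primitive hℓ (K (toEdgeL2 hℓ.le v)) := fun v => rfl
  have hpow : ∀ (m : ℕ) v (x : Icc (0 : ℝ) ℓ),
      ‖(L ^ m) v x‖ ≤ C ^ m * ‖v‖ / m.factorial * (x : ℝ) ^ m := by
    intro m v
    induction m with
    | zero => intro x; simpa using v.norm_coe_le_norm x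
    | succ m ih =>
      intro x
      rw [pow_succ', mul_apply_eq_comp, hL]
      refine (norm_primitive_apply_le hℓ hC hK m ih x).trans (le_of_eq ?_)
      rw [Nat.factorial_succ]
      push_cast
      field_simp
      ring
  have hnorm : ∀ m : ℕ, ‖L ^ m‖ ≤ (C * ℓ) ^ m / m.factorial := by
    intro m
    refine ContinuousLinearMap.opNorm_le_bound _ (by positivity) fun v => ?_
    rw [ContinuousMap.norm_le _ (by positivity)]
    intro x
    refine (hpow m v x).trans ?_
    have hx : (x : ℝ) ^ m ≤ ℓ ^ m := pow_le_pow_left₀ x.2.1 x.2.2 m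
    calc C ^ m * ‖v‖ / m.factorial * (x : ℝ) ^ m ≤ C ^ m * ‖v‖ / m.factorial * ℓ ^ m := by gcongr
      _ = _ := by rw [mul_pow]; ring
  obtain ⟨m, hm⟩ := ((FloorSemiring.tendsto_pow_div_factorial_atTop (C * ℓ)).eventually_lt_const
    one_pos).exists
  obtain ⟨v, hv⟩ := exists_eq_add_apply_of_norm_pow_lt_one ((hnorm m).trans_lt hm)
    (ContinuousMap.const _ c + primitive hℓ f)
  have hv' : ∀ x : Icc (0 : ℝ) ℓ,
      v x = c + ∫ t in 0..(x : ℝ), (K (toEdgeL2 hℓ.le v) + f : EdgeL2 ℓ n) t := by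
    intro x
    rw [← primitive_apply hℓ, map_add, ← hL]
    nth_rewrite 1 [hv]
    simp only [ContinuousMap.add_apply, ContinuousMap.const_apply]
    abel
  have hae : ∀ᵐ x ∂(volume.restrict (Ioo 0 ℓ)), toEdgeL2 hℓ.le v x
      = c + ∫ t in 0..x, (K (toEdgeL2 hℓ.le v) + f : EdgeL2 ℓ n) t := by
    filter_upwards [toEdgeL2_ae hℓ.le v, ae_restrict_mem measurableSet_Ioo] with x hx hx'
    rw [hx, hv', projIcc_of_mem _ (Ioo_subset_Icc_self hx')]
  have hw := hasWeakDeriv_of_ae_eq hae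
  refine ⟨⟨toEdgeL2 hℓ.le v, _, hw⟩, (hasWeakDeriv_weakDeriv _).unique hw, ?_⟩
  rw [pointValue_eq_of_ae_eq hℓ _
    (continuousOn_const.add (continuousOn_primitive_edgeL2 hℓ _)) hae]
  simp

end Volterra

/-! ### Absolute continuity of vector-valued primitives -/

section AbsolutelyContinuous

variable {X Y : Type*} [PseudoMetricSpace X] [PseudoMetricSpace Y] {a b : ℝ}

theorem AbsolutelyContinuousOnInterval.of_dist_le {f : ℝ → X} {φ : ℝ → Y} {C : ℝ}
    (hφ : AbsolutelyContinuousOnInterval φ a b)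
    (h : ∀ x ∈ uIcc a b, ∀ y ∈ uIcc a b, dist (f x) (f y) ≤ C * dist (φ x) (φ y)) :
    AbsolutelyContinuousOnInterval f a b := by
  have h1 := Tendsto.const_mul C hφ
  rw [mul_zero] at h1
  refine squeeze_zero' (Eventually.of_forall fun E => Finset.sum_nonneg fun i _ => dist_nonneg)
    ?_ h1
  rw [eventually_inf_principal]
  refine Eventually.of_forall fun E hE => ?_
  rw [Finset.mul_sum]
  refine Finset.sum_le_sum fun i hi => ?_
  exact h _ (hE.1 i hi).1 _ (hE.1 i hi).2

theorem AbsolutelyContinuousOnInterval.finset_sum {ι F : Type*} [NormedAddCommGroup F]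
    {f : ι → ℝ → F} (s : Finset ι)
    (h : ∀ i ∈ s, AbsolutelyContinuousOnInterval (f i) a b) :
    AbsolutelyContinuousOnInterval (fun x => ∑ i ∈ s, f i x) a b := by
  classical
  induction s using Finset.induction_on with
  | empty =>
    simp only [Finset.sum_empty]
    exact ((LipschitzWith.const (0 : F)).lipschitzOnWith (s := uIcc a b)).absolutelyContinuousOnInterval
  | insert i s hi ih =>
    simp only [Finset.sum_insert hi]
    exact (h i (Finset.mem_insert_self i s)).add
      (ih fun j hj => h j (Finset.mem_insert_of_mem hj))

/-- Increments are dominated by those of the scalar primitive of ‖g‖. -/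
theorem absolutelyContinuousOnInterval_const_add_integral {F : Type*} [NormedAddCommGroup F]
    [NormedSpace ℝ F] {g : ℝ → F} (hg : IntervalIntegrable g volume a b) (c : F) :
    AbsolutelyContinuousOnInterval (fun x => c + ∫ t in a..x, g t) a b := by
  refine (hg.norm.absolutelyContinuousOnInterval_intervalIntegral (c := a)
    left_mem_uIcc).of_dist_le (C := 1) fun x hx y hy => ?_
  have hi : ∀ x ∈ uIcc a b, IntervalIntegrable g volume a x := fun x hx =>
    hg.mono_set (uIcc_subset_uIcc_left hx)
  rw [one_mul, dist_add_left, dist_eq_norm, dist_eq_norm,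
    intervalIntegral.integral_interval_sub_left (hi x hx) (hi y hy),
    intervalIntegral.integral_interval_sub_left (hi x hx).norm (hi y hy).norm]
  exact intervalIntegral.norm_integral_le_abs_integral_norm

end AbsolutelyContinuous

/-! ### Integration by parts for a Hermitian Lipschitz weight -/

section Energy

variable {ℓ : ℝ} {n : ℕ}

theorem EdgeL2.integral_norm_sq (u : EdgeL2 ℓ n) : ∫ x in Ioo 0 ℓ, ‖u x‖ ^ 2 = ‖u‖ ^ 2 := by
  rw [← inner_self_eq_norm_sq (𝕜 := ℂ), L2.inner_def,
    ← integral_re (L2.integrable_inner (𝕜 := ℂ) u u)]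
  simp only [inner_self_eq_norm_sq]

theorem EdgeL2.integrable_norm_sq (u : EdgeL2 ℓ n) :
    Integrable (fun x => ‖u x‖ ^ 2) (volume.restrict (Ioo 0 ℓ)) :=
  (memLp_two_iff_integrable_sq_norm (Lp.aestronglyMeasurable _)).1 (Lp.memLp _)

theorem EdgeL2.re_inner (u w : EdgeL2 ℓ n) :
    (inner ℂ u w).re = ∫ x in Ioo 0 ℓ, (inner ℂ (u x) (w x)).re := by
  rw [L2.inner_def]
  exact (integral_re (L2.integrable_inner (𝕜 := ℂ) u w)).symm

theorem inner_toEuclideanLin (A : Matrix (Fin n) (Fin n) ℂ) (ξ η : EuclideanSpace ℂ (Fin n)) :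
    inner ℂ ξ (Matrix.toEuclideanLin A η)
      = ∑ i, ∑ j, (starRingEnd ℂ) (ξ i) * (A i j * η j) := by
  simp only [PiLp.inner_apply, Matrix.toLpLin_apply, Matrix.mulVec, dotProduct,
    RCLike.inner_apply, Finset.sum_mul]
  refine Finset.sum_congr rfl fun i _ => Finset.sum_congr rfl fun j _ => mul_comm _ _

theorem hasDerivAt_re_inner_toEuclideanLin {H : ℝ → Matrix (Fin n) (Fin n) ℂ}
    {H' : Matrix (Fin n) (Fin n) ℂ} {f : ℝ → EuclideanSpace ℂ (Fin n)}
    {f' : EuclideanSpace ℂ (Fin n)} {x : ℝ} (hH : ∀ i j, HasDerivAt (fun x => H x i j) (H' i j) x)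
    (hf : HasDerivAt f f' x) :
    HasDerivAt (fun x => (inner ℂ (f x) (Matrix.toEuclideanLin (H x) (f x))).re)
      ((inner ℂ f' (Matrix.toEuclideanLin (H x) (f x))).re
        + (inner ℂ (f x) (Matrix.toEuclideanLin H' (f x))).re
        + (inner ℂ (f x) (Matrix.toEuclideanLin (H x) f')).re) x := by
  have h1 : ∀ i, HasDerivAt (fun x => f x i) (f' i) x := fun i =>
    ((EuclideanSpace.proj i : EuclideanSpace ℂ (Fin n) →L[ℂ] ℂ).restrictScalars
      ℝ).hasFDerivAt.comp_hasDerivAt x hf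
  have h2 : ∀ i, HasDerivAt (fun x => (starRingEnd ℂ) (f x i)) ((starRingEnd ℂ) (f' i)) x :=
    fun i => Complex.conjCLE.toContinuousLinearMap.hasFDerivAt.comp_hasDerivAt x (h1 i)
  have h3 := HasDerivAt.fun_sum (u := Finset.univ) fun i _ => HasDerivAt.fun_sum
    (u := Finset.univ) fun j _ => (h2 i).mul ((hH i j).mul (h1 j))
  have h4 := Complex.reCLM.hasFDerivAt.comp_hasDerivAt x h3
  simp only [inner_toEuclideanLin]
  refine h4.congr_deriv ?_
  simp only [Complex.reCLM_apply, ← Complex.add_re, ← Finset.sum_add_distrib, Pi.mul_apply]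
  congr 1
  refine Finset.sum_congr rfl fun i _ => Finset.sum_congr rfl fun j _ => ?_
  ring

theorem absolutelyContinuousOnInterval_re_inner {H : ℝ → Matrix (Fin n) (Fin n) ℂ}
    {f : ℝ → EuclideanSpace ℂ (Fin n)} {a b : ℝ}
    (hH : ∀ i j, AbsolutelyContinuousOnInterval (fun x => H x i j) a b)
    (hf : AbsolutelyContinuousOnInterval f a b) :
    AbsolutelyContinuousOnInterval
      (fun x => (inner ℂ (f x) (Matrix.toEuclideanLin (H x) (f x))).re) a b := by
  have h1 : ∀ i, AbsolutelyContinuousOnInterval (fun x => f x i) a b := fun i =>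
    hf.of_dist_le (C := 1) fun x _ y _ => by
      rw [one_mul, dist_eq_norm, dist_eq_norm]
      exact PiLp.norm_apply_le (f x - f y) i
  have h2 : ∀ i, AbsolutelyContinuousOnInterval (fun x => (starRingEnd ℂ) (f x i)) a b := fun i =>
    (h1 i).of_dist_le (C := 1) fun x _ y _ => by
      rw [one_mul, Complex.dist_conj_conj]
  have h3 : AbsolutelyContinuousOnInterval
      (fun x => inner ℂ (f x) (Matrix.toEuclideanLin (H x) (f x))) a b := by
    simp only [inner_toEuclideanLin]
    refine AbsolutelyContinuousOnInterval.finset_sum _ fun i _ =>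
      AbsolutelyContinuousOnInterval.finset_sum _ fun j _ => ?_
    have h4 := (h2 i).fun_smul ((hH i j).fun_smul (h1 j))
    simpa only [smul_eq_mul] using h4
  exact h3.of_dist_le (C := 1) fun x _ y _ => by
    rw [one_mul, Real.dist_eq, dist_eq_norm, ← Complex.sub_re]
    exact Complex.abs_re_le_norm _

/-- Almost everywhere f' = g and the Lipschitz entries of H are differentiable. As H is Hermitian,
the product rule reads ⟨f, Hf⟩' = 2 Re ⟨f, Hg⟩ + ⟨f, H'f⟩ in real parts; the n² entries of H' are at
most K in modulus, which gives the constant n²K. -/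
theorem ae_two_mul_re_inner_le (hℓ : 0 < ℓ) {H : ℝ → Matrix (Fin n) (Fin n) ℂ} {K : ℝ≥0}
    (hH : ∀ i j, LipschitzOnWith K (fun x => H x i j) (Icc 0 ℓ))
    (hherm : ∀ x ∈ Icc 0 ℓ, (H x).IsHermitian) (g : EdgeL2 ℓ n)
    {f : ℝ → EuclideanSpace ℂ (Fin n)} {c : EuclideanSpace ℂ (Fin n)}
    (hf : ∀ x, f x = c + ∫ t in 0..x, g t) :
    ∀ᵐ x, x ∈ Ioo 0 ℓ → 2 * (inner ℂ (f x) (Matrix.toEuclideanLin (H x) (g x))).re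
      ≤ deriv (fun x => (inner ℂ (f x) (Matrix.toEuclideanLin (H x) (f x))).re) x
        + (n * (n * K)) * ‖f x‖ ^ 2 := by
  have h1 : ∀ i j, ∀ᵐ x, x ∈ Icc 0 ℓ →
      DifferentiableWithinAt ℝ (fun x => H x i j) (Icc 0 ℓ) x := fun i j =>
    (hH i j).ae_differentiableWithinAt_of_mem
  have h0 := left_mem_Icc.2 hℓ.le
  have h2 := (g.intervalIntegrable hℓ h0 (right_mem_Icc.2 hℓ.le)).ae_hasDerivAt_integral
  filter_upwards [ae_all_iff.2 fun i => ae_all_iff.2 (h1 i), h2] with x hx1 hx2 hx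
  have hx' := Ioo_subset_Icc_self hx
  have hnhds : Icc 0 ℓ ∈ 𝓝 x := Icc_mem_nhds hx.1 hx.2
  have hd : ∀ i j, HasDerivAt (fun x => H x i j) (deriv (fun x => H x i j) x) x := fun i j =>
    ((hx1 i j hx').differentiableAt hnhds).hasDerivAt
  have hf' : HasDerivAt f (g x) x := by
    rw [show f = fun x => c + ∫ t in 0..x, g t from funext hf]
    rw [uIcc_of_le hℓ.le] at hx2
    exact (hx2 hx' 0 h0).const_add c
  rw [(hasDerivAt_re_inner_toEuclideanLin (H' := fun i j => deriv (fun x => H x i j) x)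
    hd hf').deriv]
  have hsym : (inner ℂ (g x) (Matrix.toEuclideanLin (H x) (f x))).re
      = (inner ℂ (f x) (Matrix.toEuclideanLin (H x) (g x))).re := by
    have := Matrix.isSymmetric_toEuclideanLin_iff.2 (hherm x hx') (f x) (g x)
    rw [← this, ← inner_conj_symm, Complex.conj_re]
  have hb := norm_toEuclideanLin_apply_le (fun i j => deriv (fun x => H x i j) x) (f x)
  have hK : (∑ i : Fin n, ∑ j : Fin n, ‖deriv (fun x => H x i j) x‖) ≤ n * (n * K) := by
    calc _ ≤ ∑ i : Fin n, ∑ j : Fin n, (K : ℝ) := by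
          gcongr with i _ j _
          exact norm_deriv_le_of_lipschitzOn hnhds (hH i j)
      _ = _ := by simp
  have hc := (abs_le.1 ((Complex.abs_re_le_norm _).trans (norm_inner_le_norm (𝕜 := ℂ) (f x)
    (Matrix.toEuclideanLin (fun i j => deriv (fun x => H x i j) x) (f x))))).1
  have hc2 : ‖f x‖ * ‖Matrix.toEuclideanLin (fun i j => deriv (fun x => H x i j) x) (f x)‖
      ≤ n * (n * K) * ‖f x‖ ^ 2 := by
    calc _ ≤ ‖f x‖ * (n * (n * K) * ‖f x‖) := by
          gcongr
          exact hb.trans (by gcongr)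
      _ = _ := by ring
  linarith

/-- The function Re ⟨u, Hu⟩ is absolutely continuous, so the pointwise inequality can be integrated
and its derivative contributes just the two endpoint values. -/
theorem two_mul_integral_re_inner_le (hℓ : 0 < ℓ) {H : ℝ → Matrix (Fin n) (Fin n) ℂ} {K : ℝ≥0}
    (hH : ∀ i j, LipschitzOnWith K (fun x => H x i j) (Icc 0 ℓ))
    (hherm : ∀ x ∈ Icc 0 ℓ, (H x).IsHermitian) (u : EdgeH1 ℓ n) {w : EdgeL2 ℓ n}
    (hw : ∀ᵐ x ∂(volume.restrict (Ioo 0 ℓ)), w x = Matrix.toEuclideanLin (H x) (weakDeriv u x)) :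
    2 * (inner ℂ (u : EdgeL2 ℓ n) w).re
      ≤ (inner ℂ (pointValue hℓ ⟨ℓ, right_mem_Icc.2 hℓ.le⟩ u)
          (Matrix.toEuclideanLin (H ℓ) (pointValue hℓ ⟨ℓ, right_mem_Icc.2 hℓ.le⟩ u))).re
        - (inner ℂ (pointValue hℓ ⟨0, left_mem_Icc.2 hℓ.le⟩ u)
          (Matrix.toEuclideanLin (H 0) (pointValue hℓ ⟨0, left_mem_Icc.2 hℓ.le⟩ u))).re
        + n * (n * K) * ‖(u : EdgeL2 ℓ n)‖ ^ 2 := by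
  obtain ⟨c, hc, hp⟩ := exists_eq_primitive hℓ u
  rw [hp, hp]
  set f : ℝ → EuclideanSpace ℂ (Fin n) := fun x => c + ∫ t in 0..x, weakDeriv u t with hf
  set h : ℝ → ℝ := fun x => (inner ℂ (f x) (Matrix.toEuclideanLin (H x) (f x))).re with hh
  have hac : AbsolutelyContinuousOnInterval h 0 ℓ := by
    refine absolutelyContinuousOnInterval_re_inner (fun i j => ?_)
      (absolutelyContinuousOnInterval_const_add_integral ((weakDeriv u).intervalIntegrable hℓ
        (left_mem_Icc.2 hℓ.le) (right_mem_Icc.2 hℓ.le)) c)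
    refine LipschitzOnWith.absolutelyContinuousOnInterval (K := K) ?_
    rw [uIcc_of_le hℓ.le]
    exact hH i j
  have hint : ∫ x in Ioo 0 ℓ, deriv h x = h ℓ - h 0 := by
    rw [← hac.integral_deriv_eq_sub, intervalIntegral.integral_of_le hℓ.le,
      integral_Ioc_eq_integral_Ioo]
  have hdi : Integrable (deriv h) (volume.restrict (Ioo 0 ℓ)) :=
    (intervalIntegrable_iff_integrableOn_Ioo_of_le hℓ.le).1 hac.intervalIntegrable_deriv
  rw [EdgeL2.re_inner, ← integral_const_mul, ← EdgeL2.integral_norm_sq, ← integral_const_mul]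
  change _ ≤ h ℓ - h 0 + _
  rw [← hint, ← integral_add hdi ((EdgeL2.integrable_norm_sq _).const_mul _)]
  refine integral_mono_ae ((L2.integrable_inner (𝕜 := ℂ) (u : EdgeL2 ℓ n) w).re.const_mul 2)
    (hdi.add ((EdgeL2.integrable_norm_sq _).const_mul _)) ?_
  have := ae_two_mul_re_inner_le hℓ hH hherm (weakDeriv u) (f := f) (fun x => rfl)
  filter_upwards [(ae_restrict_iff' measurableSet_Ioo).2 this, hc, hw] with x h1 h2 h3
  rw [h3, h2]
  exact h1

end Energy

/-! ### The resolvent equation and the symmetrizer on a single edge -/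

section Edge

variable {ℓ : ℝ} {n : ℕ}

theorem exists_lipschitzOnWith_mul {s : Set ℝ} (hs : IsCompact s) {f g : ℝ → ℂ} {K K' : ℝ≥0}
    (hf : LipschitzOnWith K f s) (hg : LipschitzOnWith K' g s) :
    ∃ K'' : ℝ≥0, LipschitzOnWith K'' (fun x => f x * g x) s := by
  obtain ⟨C, hC⟩ := hs.exists_bound_of_continuousOn hf.continuousOn
  obtain ⟨D, hD⟩ := hs.exists_bound_of_continuousOn hg.continuousOn
  refine ⟨Real.toNNReal C * K' + Real.toNNReal D * K,
    LipschitzOnWith.of_dist_le_mul fun x hx y hy => ?_⟩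
  have h1 := hf.dist_le_mul x hx y hy
  have h2 := hg.dist_le_mul x hx y hy
  rw [dist_eq_norm] at h1 h2 ⊢
  have e : f x * g x - f y * g y = f x * (g x - g y) + g y * (f x - f y) := by ring
  have hC' := (hC x hx).trans (Real.le_coe_toNNReal C)
  have hD' := (hD y hy).trans (Real.le_coe_toNNReal D)
  rw [e]
  calc _ ≤ ‖f x‖ * ‖g x - g y‖ + ‖g y‖ * ‖f x - f y‖ := by
        refine (norm_add_le _ _).trans ?_
        rw [norm_mul, norm_mul]
    _ ≤ Real.toNNReal C * (K' * dist x y) + Real.toNNReal D * (K * dist x y) := by gcongr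
    _ = _ := by push_cast; ring

theorem exists_lipschitzOnWith_matrix_mul {s : Set ℝ} (hs : IsCompact s)
    {F G : ℝ → Matrix (Fin n) (Fin n) ℂ} {K K' : ℝ≥0}
    (hF : ∀ i j, LipschitzOnWith K (fun x => F x i j) s)
    (hG : ∀ i j, LipschitzOnWith K' (fun x => G x i j) s) :
    ∃ K'' : ℝ≥0, ∀ i j, LipschitzOnWith K'' (fun x => (F x * G x) i j) s := by
  choose L hL using fun i j k => exists_lipschitzOnWith_mul hs (hF i k) (hG k j)
  refine ⟨∑ i, ∑ j, ∑ k, L i j k, fun i j => LipschitzOnWith.of_dist_le_mul fun x hx y hy => ?_⟩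
  simp only [Matrix.mul_apply]
  have h1 : ∑ k, L i j k ≤ ∑ i, ∑ j, ∑ k, L i j k :=
    (Finset.single_le_sum (f := fun j => ∑ k, L i j k) (fun _ _ => zero_le)
      (Finset.mem_univ j)).trans (Finset.single_le_sum (f := fun i => ∑ j, ∑ k, L i j k)
      (fun _ _ => zero_le) (Finset.mem_univ i))
  calc _ ≤ ∑ k, dist (F x i k * G x k j) (F y i k * G y k j) := dist_sum_sum_le _ _ _
    _ ≤ ∑ k, (L i j k : ℝ) * dist x y := by
        gcongr with k _
        exact (hL i j k).dist_le_mul x hx y hy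
    _ = ((∑ k, L i j k : ℝ≥0) : ℝ) * dist x y := by rw [← Finset.sum_mul]; push_cast; rfl
    _ ≤ _ := by gcongr

theorem exists_norm_matrixMul_le {F : ℝ → Matrix (Fin n) (Fin n) ℂ}
    (hF : ∀ i j, MemLp (fun x => F x i j) ∞ (volume.restrict (Ioo (0 : ℝ) ℓ))) :
    ∃ C, 0 ≤ C ∧ ∀ u : EdgeL2 ℓ n, ‖matrixMul F hF u‖ ≤ C * ‖u‖ := by
  obtain ⟨C, hC, h⟩ := exists_matrixMul_bound hF
  exact ⟨C, hC, fun u => Lp.norm_le_mul_norm_of_ae_le_mul (h u)⟩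

theorem isSymmetric_matrixMul {F : ℝ → Matrix (Fin n) (Fin n) ℂ}
    (hF : ∀ i j, MemLp (fun x => F x i j) ∞ (volume.restrict (Ioo (0 : ℝ) ℓ)))
    (hherm : ∀ x ∈ Icc 0 ℓ, (F x).IsHermitian) : (matrixMul F hF).IsSymmetric := by
  intro u v
  rw [L2.inner_def, L2.inner_def]
  refine integral_congr_ae ?_
  filter_upwards [matrixMul_ae hF u, matrixMul_ae hF v, ae_restrict_mem measurableSet_Ioo]
    with x h1 h2 hx
  rw [h1, h2]
  exact Matrix.isSymmetric_toEuclideanLin_iff.2 (hherm x (Ioo_subset_Icc_self hx)) _ _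

theorem le_re_inner_matrixMul {F : ℝ → Matrix (Fin n) (Fin n) ℂ}
    (hF : ∀ i j, MemLp (fun x => F x i j) ∞ (volume.restrict (Ioo (0 : ℝ) ℓ))) {q : ℝ}
    (hq : ∀ x ∈ Icc 0 ℓ, ∀ ξ : EuclideanSpace ℂ (Fin n),
      q * ‖ξ‖ ^ 2 ≤ (inner ℂ ξ (Matrix.toEuclideanLin (F x) ξ)).re) (u : EdgeL2 ℓ n) :
    q * ‖u‖ ^ 2 ≤ (inner ℂ u (matrixMul F hF u)).re := by
  rw [← u.integral_norm_sq, u.re_inner, ← integral_const_mul]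
  refine integral_mono_ae (u.integrable_norm_sq.const_mul q)
    (L2.integrable_inner (𝕜 := ℂ) u (matrixMul F hF u)).re ?_
  filter_upwards [matrixMul_ae hF u, ae_restrict_mem measurableSet_Ioo] with x h1 hx
  simp only [h1]
  exact hq x (Ioo_subset_Icc_self hx) _

/-- Inverting M turns the equation into u' = M⁻¹(μ - N)u - M⁻¹f; the inverse is continuous on the
compact interval, hence bounded. -/
theorem exists_edgeH1_resolvent_eq (hℓ : 0 < ℓ) {M N : ℝ → Matrix (Fin n) (Fin n) ℂ}
    (hMc : ∀ i j, ContinuousOn (fun x => M x i j) (Icc 0 ℓ))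
    (hMu : ∀ x ∈ Icc 0 ℓ, IsUnit (M x))
    (hM : ∀ i j, MemLp (fun x => M x i j) ∞ (volume.restrict (Ioo (0 : ℝ) ℓ)))
    (hN : ∀ i j, MemLp (fun x => N x i j) ∞ (volume.restrict (Ioo (0 : ℝ) ℓ)))
    (μ : ℂ) (f : EdgeL2 ℓ n) (c : EuclideanSpace ℂ (Fin n)) :
    ∃ u : EdgeH1 ℓ n,
      μ • (u : EdgeL2 ℓ n) - (matrixMul M hM (weakDeriv u) + matrixMul N hN u) = f ∧
      pointValue hℓ ⟨0, left_mem_Icc.2 hℓ.le⟩ u = c := by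
  have hI : ∀ i j, MemLp (fun x => (M x)⁻¹ i j) ∞ (volume.restrict (Ioo (0 : ℝ) ℓ)) :=
    fun i j => memLp_top_of_continuousOn (continuousOn_matrix_inv_apply hMc hMu i j)
  let I : EdgeL2 ℓ n →ₗ[ℂ] EdgeL2 ℓ n := matrixMul (fun x => (M x)⁻¹) hI
  obtain ⟨C, hC, hCI⟩ := exists_matrixMul_bound hI
  obtain ⟨D, hD, hDN⟩ := exists_matrixMul_bound hN
  obtain ⟨u, hu, huc⟩ := exists_edgeH1_of_weakDeriv_eq hℓ
    (K := I ∘ₗ (μ • LinearMap.id - matrixMul N hN)) (C := C * (‖μ‖ + D)) (by positivity)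
    (fun u => by
      filter_upwards [hCI (μ • u - matrixMul N hN u), hDN u, Lp.coeFn_smul μ u,
        Lp.coeFn_sub (μ • u) (matrixMul N hN u)] with x h1 h2 h3 h4
      refine h1.trans ?_
      rw [mul_assoc]
      gcongr
      rw [h4, Pi.sub_apply, h3, Pi.smul_apply]
      refine (norm_sub_le _ _).trans ?_
      rw [norm_smul, add_mul]
      gcongr) (-(I f)) c
  refine ⟨u, ?_, huc⟩
  have hMI : ∀ w : EdgeL2 ℓ n, matrixMul M hM (I w) = w := by
    intro w
    apply Lp.ext
    filter_upwards [matrixMul_ae hM (I w), matrixMul_ae hI w, ae_restrict_mem measurableSet_Ioo]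
      with x h1 h2 hx
    rw [h1, h2, ← LinearMap.comp_apply, ← Matrix.toLpLin_mul,
      Matrix.mul_nonsing_inv _ ((Matrix.isUnit_iff_isUnit_det _).1
        (hMu x (Ioo_subset_Icc_self hx)))]
    simp
  rw [hu, map_add, map_neg, hMI, LinearMap.comp_apply, hMI]
  simp only [LinearMap.sub_apply, LinearMap.smul_apply, LinearMap.id_apply]
  abel

end Edge

/-! ### Uniform constants over finite families -/

section CommonBounds

theorem exists_common_bound {ι : Type*} [Finite ι] {P : ι → ℝ → Prop}
    (hmono : ∀ i a b, a ≤ b → P i a → P i b) (h : ∀ i, ∃ C, 0 ≤ C ∧ P i C) :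
    ∃ C, 0 ≤ C ∧ ∀ i, P i C := by
  have := Fintype.ofFinite ι
  choose C hC hP using h
  exact ⟨∑ i, C i, Finset.sum_nonneg fun i _ => hC i, fun i =>
    hmono i _ _ (Finset.single_le_sum (fun i _ => hC i) (Finset.mem_univ i)) (hP i)⟩

theorem exists_common_pos {ι : Type*} [Finite ι] {P : ι → ℝ → Prop}
    (hmono : ∀ i a b, a ≤ b → P i b → P i a) (h : ∀ i, ∃ q, 0 < q ∧ P i q) :
    ∃ q, 0 < q ∧ ∀ i, P i q := by
  choose q hq hP using h
  cases isEmpty_or_nonempty ι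
  · exact ⟨1, one_pos, fun i => isEmptyElim i⟩
  · obtain ⟨i₀, hi₀⟩ := Finite.exists_min q
    exact ⟨q i₀, hq i₀, fun i => hmono i _ _ (hi₀ i) (hP i)⟩

end CommonBounds

/-! ### Energy balance and solvability on the network -/

namespace Network

variable {V E : Type*} {G : Network V E}

namespace Coefficients

/-- Multiplication by the symmetrizer `Q_e`. -/
noncomputable def symmetrizer (c : G.Coefficients) (e : E) :
    EdgeL2 (G.length e) (G.dim e) →ₗ[ℂ] EdgeL2 (G.length e) (G.dim e) :=
  matrixMul (c.Q e) fun i j => memLp_top_of_lipschitz ((c.Q_lipschitz e).choose_spec i j)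

/-- The endpoint form `ξ ↦ Re (Q_e(x) M_e(x) ξ ⬝ ξ̄)`. -/
noncomputable def endpointForm (c : G.Coefficients) (e : E) (x : ℝ)
    (ξ : EuclideanSpace ℂ (Fin (G.dim e))) : ℝ :=
  (inner ℂ ξ (Matrix.toEuclideanLin (c.Q e x * c.M e x) ξ)).re

theorem exists_edge_energy_le (c : G.Coefficients) (e : E) :
    ∃ C, 0 ≤ C ∧ ∀ u : EdgeH1 (G.length e) (G.dim e),
      2 * (inner ℂ (u : EdgeL2 (G.length e) (G.dim e)) (c.symmetrizer e
        (matrixMul (c.M e) (fun i j => memLp_top_of_lipschitz ((c.M_lipschitz e).choose_spec i j))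
          (weakDeriv u) + matrixMul (c.N e) (c.N_bounded e) u))).re
      ≤ c.endpointForm e (G.length e)
            (pointValue (G.length_pos e) ⟨_, right_mem_Icc.2 (G.length_pos e).le⟩ u)
          - c.endpointForm e 0
            (pointValue (G.length_pos e) ⟨0, left_mem_Icc.2 (G.length_pos e).le⟩ u)
          + C * ‖(u : EdgeL2 (G.length e) (G.dim e))‖ ^ 2 := by
  obtain ⟨K, hK⟩ := exists_lipschitzOnWith_matrix_mul isCompact_Icc
    (c.Q_lipschitz e).choose_spec (c.M_lipschitz e).choose_spec
  obtain ⟨C, hC, hQ⟩ := exists_norm_matrixMul_le fun i j =>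
    memLp_top_of_lipschitz ((c.Q_lipschitz e).choose_spec i j)
  obtain ⟨D, hD, hN⟩ := exists_norm_matrixMul_le (c.N_bounded e)
  refine ⟨G.dim e * (G.dim e * K) + 2 * (C * D), by positivity, fun u => ?_⟩
  set M := matrixMul (c.M e) fun i j => memLp_top_of_lipschitz ((c.M_lipschitz e).choose_spec i j)
  set N := matrixMul (c.N e) (c.N_bounded e)
  have h1 := two_mul_integral_re_inner_le (G.length_pos e) hK (c.QM_hermitian e) u
    (w := c.symmetrizer e (M (weakDeriv u))) (by
      filter_upwards [matrixMul_ae (fun i j =>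
          memLp_top_of_lipschitz ((c.Q_lipschitz e).choose_spec i j)) (M (weakDeriv u)),
        matrixMul_ae (fun i j => memLp_top_of_lipschitz ((c.M_lipschitz e).choose_spec i j))
          (weakDeriv u)] with x h1 h2
      rw [Matrix.toLpLin_mul, LinearMap.comp_apply, ← h2, ← h1]
      rfl)
  have h2 : (inner ℂ (u : EdgeL2 (G.length e) (G.dim e)) (c.symmetrizer e (N u))).re
      ≤ C * D * ‖(u : EdgeL2 (G.length e) (G.dim e))‖ ^ 2 := by
    refine (re_inner_le_norm (𝕜 := ℂ) _ _).trans ?_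
    have h3 : ‖c.symmetrizer e (N u)‖ ≤ C * (D * ‖(u : EdgeL2 (G.length e) (G.dim e))‖) :=
      (hQ _).trans (by gcongr; exact hN _)
    calc _ ≤ ‖(u : EdgeL2 (G.length e) (G.dim e))‖
          * (C * (D * ‖(u : EdgeL2 (G.length e) (G.dim e))‖)) := by gcongr
      _ = _ := by ring
  rw [map_add, inner_add_right, Complex.add_re]
  simp only [endpointForm]
  linarith

theorem isSymmetric_symmetrizer (c : G.Coefficients) (e : E) : (c.symmetrizer e).IsSymmetric :=
  isSymmetric_matrixMul _ (c.Q_hermitian e)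

theorem exists_le_re_inner_symmetrizer (c : G.Coefficients) (e : E) :
    ∃ q, 0 < q ∧ ∀ u, q * ‖u‖ ^ 2 ≤ (inner ℂ u (c.symmetrizer e u)).re := by
  obtain ⟨q, hq, h⟩ := c.Q_pos e
  exact ⟨q, hq, fun u => le_re_inner_matrixMul _ h u⟩

open Classical in
-- T_v is block diagonal, so the form splits over the incident edges, with sign + at a terminal and
-- - at an initial endpoint. The sum is extended to all edges, so that it can be interchanged with a
-- sum over the vertices.
theorem re_inner_T [Fintype E] (c : G.Coefficients) (v : V) (u : G.Dmax) :
    (inner ℂ (G.trace v u) (c.T v (G.trace v u))).re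
      = ∑ e, ((if G.tgt e = v then c.endpointForm e (G.length e)
            (pointValue (G.length_pos e) ⟨_, right_mem_Icc.2 (G.length_pos e).le⟩
              (G.edgePart e u)) else 0)
          - if G.src e = v then c.endpointForm e 0
            (pointValue (G.length_pos e) ⟨0, left_mem_Icc.2 (G.length_pos e).le⟩
              (G.edgePart e u)) else 0) := by
  have h1 : inner ℂ (G.trace v u) (c.T v (G.trace v u))
      = ∑ e : G.Incident v, G.incidence v e.1 *
        inner ℂ (pointValue (G.length_pos e.1) (G.position v e) (G.edgePart e.1 u))
          (Matrix.toEuclideanLin (c.Q e.1 (G.position v e) * c.M e.1 (G.position v e))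
            (pointValue (G.length_pos e.1) (G.position v e) (G.edgePart e.1 u))) := by
    rw [PiLp.inner_apply, Fintype.sum_sigma]
    refine Finset.sum_congr rfl fun e _ => ?_
    rw [PiLp.inner_apply, Finset.mul_sum]
    refine Finset.sum_congr rfl fun i _ => ?_
    have h2 : c.T v (G.trace v u) ⟨e, i⟩ = G.incidence v e.1 *
        Matrix.toEuclideanLin (c.Q e.1 (G.position v e) * c.M e.1 (G.position v e))
            (pointValue (G.length_pos e.1) (G.position v e) (G.edgePart e.1 u)) i := by
      simp only [T, Matrix.toLpLin_apply, Matrix.mulVec, dotProduct]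
      rw [Fintype.sum_sigma, Finset.sum_eq_single e]
      · simp only [Matrix.blockDiagonal'_apply_eq, Matrix.smul_apply, smul_eq_mul, mul_assoc,
          ← Finset.mul_sum]
        rfl
      · intro e' _ he'
        refine Finset.sum_eq_zero fun j _ => ?_
        rw [Matrix.blockDiagonal'_apply_ne _ _ _ he'.symm, zero_mul]
      · simp
    rw [h2, ← smul_eq_mul (G.incidence v e.1), ← smul_eq_mul (G.incidence v e.1), inner_smul_right]
    rfl
  rw [h1, Complex.re_sum]
  refine Fintype.sum_of_injective (M := ℝ) (fun e : G.Incident v => e.1)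
    (fun a b h => Subtype.ext h) _ _ (fun e he => ?_) (fun e => ?_)
  · have : ¬ (G.src e = v ∨ G.tgt e = v) := fun h => he ⟨⟨e, h⟩, rfl⟩
    rw [not_or] at this
    simp [this.1, this.2]
  · obtain ⟨e, he⟩ := e
    by_cases ht : G.tgt e = v
    -- On a loop the two incidence signs would cancel and only one endpoint would be seen.
    · have hs : G.src e ≠ v := fun h => G.src_ne_tgt e (h.trans ht.symm)
      have hp : G.position v ⟨e, he⟩ = ⟨_, right_mem_Icc.2 (G.length_pos e).le⟩ := if_pos ht
      simp only [hp, incidence, if_pos ht, if_neg hs, sub_zero, one_mul, endpointForm]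
    · have hs : G.src e = v := he.resolve_right ht
      have hp : G.position v ⟨e, he⟩ = ⟨0, left_mem_Icc.2 (G.length_pos e).le⟩ := if_neg ht
      simp only [hp, incidence, if_neg ht, if_pos hs, zero_sub, neg_mul, one_mul, endpointForm,
        Complex.neg_re]

/-- Each end of an edge is attached to exactly one vertex, so summing over v recovers every endpoint
term once. -/
theorem sum_re_inner_T [Fintype V] [Fintype E] (c : G.Coefficients) (u : G.Dmax) :
    ∑ v, (inner ℂ (G.trace v u) (c.T v (G.trace v u))).re
      = ∑ e, (c.endpointForm e (G.length e)
            (pointValue (G.length_pos e) ⟨_, right_mem_Icc.2 (G.length_pos e).le⟩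
              (G.edgePart e u))
          - c.endpointForm e 0
            (pointValue (G.length_pos e) ⟨0, left_mem_Icc.2 (G.length_pos e).le⟩
              (G.edgePart e u))) := by
  classical
  simp only [re_inner_T]
  rw [Finset.sum_comm]
  refine Finset.sum_congr rfl fun e _ => ?_
  rw [Finset.sum_sub_distrib, Finset.sum_ite_eq, Finset.sum_ite_eq]
  simp

theorem exists_energy_le [Fintype V] [Fintype E] (c : G.Coefficients) :
    ∃ C, 0 ≤ C ∧ ∀ u : G.Dmax,
      2 * ∑ e, (inner ℂ (u.1 e) (c.symmetrizer e (c.opA u e))).re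
        ≤ ∑ v, (inner ℂ (G.trace v u) (c.T v (G.trace v u))).re + C * ‖(u : G.L2)‖ ^ 2 := by
  obtain ⟨C, hC, h⟩ := exists_common_bound (fun e a b hab h u => (h u).trans (by gcongr))
    c.exists_edge_energy_le
  refine ⟨C, hC, fun u => ?_⟩
  rw [sum_re_inner_T, Finset.mul_sum, PiLp.norm_sq_eq_of_L2, Finset.mul_sum,
    ← Finset.sum_add_distrib]
  exact Finset.sum_le_sum fun e _ => h e (G.edgePart e u)

theorem exists_opA_eq [Fintype E] (c : G.Coefficients) (μ : ℂ) (f : G.L2)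
    (a : ∀ e, EuclideanSpace ℂ (Fin (G.dim e))) :
    ∃ u : G.Dmax, μ • (u : G.L2) - c.opA u = f ∧ ∀ e,
      pointValue (G.length_pos e) ⟨0, left_mem_Icc.2 (G.length_pos e).le⟩ (G.edgePart e u)
        = a e := by
  choose u hu ha using fun e => exists_edgeH1_resolvent_eq (G.length_pos e)
    (fun i j => ((c.M_lipschitz e).choose_spec i j).continuousOn) (c.M_invertible e)
    (fun i j => memLp_top_of_lipschitz ((c.M_lipschitz e).choose_spec i j)) (c.N_bounded e) μ
    (f e) (a e)
  refine ⟨⟨WithLp.toLp 2 fun e => (u e : EdgeL2 (G.length e) (G.dim e)), fun e => (u e).2⟩, ?_, ha⟩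
  ext1 e
  exact hu e

end Coefficients

end Network

/-! ### Finite-dimensional estimates at a vertex -/

section FiniteDimensional

theorem exists_pos_mul_norm_sq_le {F : Type*} [NormedAddCommGroup F] [InnerProductSpace ℂ F]
    [FiniteDimensional ℂ F] (Q : F →ₗ[ℂ] F) (hQ : ∀ x, x ≠ 0 → 0 < (inner ℂ x (Q x)).re) :
    ∃ q, 0 < q ∧ ∀ x, q * ‖x‖ ^ 2 ≤ (inner ℂ x (Q x)).re := by
  have hpr : ProperSpace F := FiniteDimensional.proper ℂ F
  rcases (Metric.sphere (0 : F) 1).eq_empty_or_nonempty with hS | hS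
  · refine ⟨1, one_pos, fun x => ?_⟩
    have hx : x = 0 := by
      by_contra hx
      have : ((‖x‖ : ℂ)⁻¹ • x) ∈ Metric.sphere (0 : F) 1 := by
        simp [norm_smul, norm_ne_zero_iff.2 hx]
      rw [hS] at this
      exact this
    simp [hx]
  · have hc : Continuous fun x => (inner ℂ x (Q x)).re :=
      Complex.continuous_re.comp (continuous_id.inner Q.continuous_of_finiteDimensional)
    obtain ⟨x₀, hx₀, hmin⟩ := (isCompact_sphere (0 : F) 1).exists_isMinOn hS hc.continuousOn
    have hne : x₀ ≠ 0 := by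
      rintro rfl
      simp at hx₀
    refine ⟨_, hQ x₀ hne, fun x => ?_⟩
    rcases eq_or_ne x 0 with rfl | hx
    · simp
    have hx' : ‖x‖ ≠ 0 := norm_ne_zero_iff.2 hx
    have h1 : ((‖x‖ : ℂ)⁻¹ • x) ∈ Metric.sphere (0 : F) 1 := by
      simp [norm_smul, hx']
    have h2 : (inner ℂ x₀ (Q x₀)).re ≤ _ := hmin h1
    have h3 : (inner ℂ ((‖x‖ : ℂ)⁻¹ • x) (Q ((‖x‖ : ℂ)⁻¹ • x))).re
        = (‖x‖ ^ 2)⁻¹ * (inner ℂ x (Q x)).re := by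
      rw [map_smul, inner_smul_left, inner_smul_right, ← Complex.ofReal_inv, Complex.conj_ofReal,
        Complex.re_ofReal_mul, Complex.re_ofReal_mul]
      ring
    simp only [h3] at h2
    rwa [inv_mul_eq_div, le_div_iff₀ (by positivity)] at h2

theorem exists_re_inner_le_mul_norm_sq {F : Type*} [NormedAddCommGroup F] [InnerProductSpace ℂ F]
    [FiniteDimensional ℂ F] (L : F →ₗ[ℂ] F) :
    ∃ C, 0 ≤ C ∧ ∀ x, (inner ℂ x (L x)).re ≤ C * ‖x‖ ^ 2 := by
  refine ⟨‖L.toContinuousLinearMap‖, norm_nonneg _, fun x => ?_⟩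
  refine (re_inner_le_norm (𝕜 := ℂ) _ _).trans ?_
  calc ‖x‖ * ‖L x‖ ≤ ‖x‖ * (‖L.toContinuousLinearMap‖ * ‖x‖) := by
        gcongr
        exact L.toContinuousLinearMap.le_opNorm x
    _ = _ := by ring

theorem eq_zero_of_quasiDissipative {H : Type*} [NormedAddCommGroup H] [InnerProductSpace ℂ H]
    {Q : H →ₗ[ℂ] H} {q : ℝ} (hq : 0 < q) (hpos : ∀ x, q * ‖x‖ ^ 2 ≤ (inner ℂ x (Q x)).re)
    {A : H →ₗ.[ℂ] H} {κ : ℝ}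
    (hA : ∀ x : A.domain, (inner ℂ (x : H) (Q (A x))).re ≤ κ * (inner ℂ (x : H) (Q x)).re)
    {μ : ℝ} (hμ : κ < μ) {x : A.domain} (hx : (μ : ℂ) • (x : H) - A x = 0) : x = 0 := by
  have h1 := hA x
  rw [← sub_eq_zero.1 hx, map_smul, inner_smul_right, Complex.re_ofReal_mul] at h1
  have h2 := hpos x
  by_contra hne
  have h3 : 0 < ‖(x : H)‖ := norm_pos_iff.2 fun h => hne (Subtype.ext h)
  have h4 : 0 < (inner ℂ (x : H) (Q x)).re := lt_of_lt_of_le (by positivity) h2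
  nlinarith

/-- Ker B^* is the orthogonal complement of Ran B. -/
theorem finrank_range_add_finrank_ker_adjoint {F K : Type*} [NormedAddCommGroup F]
    [InnerProductSpace ℂ F] [FiniteDimensional ℂ F] [NormedAddCommGroup K] [InnerProductSpace ℂ K]
    [FiniteDimensional ℂ K] (B : F →ₗ[ℂ] K) :
    Module.finrank ℂ B.range + Module.finrank ℂ (LinearMap.adjoint B).ker
      = Module.finrank ℂ K := by
  have h : (LinearMap.adjoint B).ker = B.rangeᗮ := by
    ext η
    rw [LinearMap.mem_ker, Submodule.mem_orthogonal]
    constructor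
    · rintro h _ ⟨ξ, rfl⟩
      rw [← LinearMap.adjoint_inner_right, h, inner_zero_right]
    · intro h
      rw [← inner_self_eq_zero (𝕜 := ℂ), LinearMap.adjoint_inner_right]
      exact h _ ⟨_, rfl⟩
  rw [h, Submodule.finrank_add_finrank_orthogonal]

/-- Pairing ξ with a vector of Z sees only its projection x, and Q is symmetric. Hence the QB-term
and the B^*Q-term have the same real part, Re ⟨x, QBξ⟩, which accounts for the factor 2. -/
theorem re_inner_add_two_mul_le_of_cone {F : Type*} [NormedAddCommGroup F] [InnerProductSpace ℂ F]
    [FiniteDimensional ℂ F] {Y Z : Submodule ℂ F} (T : F →ₗ[ℂ] F) (B : Y →ₗ[ℂ] Z) {Q : Z →ₗ[ℂ] Z}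
    (hQ : ∀ x y : Z, inner ℂ (Q x) y = inner ℂ x (Q y)) {r : ℝ} {ξ : Y} {x : Z}
    (hx : x = Z.orthogonalProjectionOnto (ξ : F))
    (h : (inner ℂ (ξ : F) (T ξ + (Q (B ξ) : F) + (LinearMap.adjoint B (Q x) : F)
      - (r : ℂ) • (Q x : F))).re ≤ 0) :
    (inner ℂ (ξ : F) (T ξ)).re + 2 * (inner ℂ x (Q (B ξ))).re ≤ r * (inner ℂ x (Q x)).re := by
  have h1 : ∀ y : Z, inner ℂ (ξ : F) (y : F) = inner ℂ x y := fun y => by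
    rw [hx]
    exact (Z.inner_orthogonalProjectionOnto_eq_of_mem_right y (ξ : F)).symm
  have h2 : inner ℂ (ξ : F) (LinearMap.adjoint B (Q x) : F) = inner ℂ (B ξ) (Q x) := by
    rw [← Submodule.coe_inner, LinearMap.adjoint_inner_right]
  have h3 : (inner ℂ (B ξ) (Q x)).re = (inner ℂ x (Q (B ξ))).re := by
    rw [← hQ, ← inner_conj_symm, Complex.conj_re]
  rw [inner_sub_right, inner_add_right, inner_add_right, inner_smul_right, h1, h1, h2,
    Complex.sub_re, Complex.add_re, Complex.add_re, Complex.re_ofReal_mul, h3] at h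
  linarith

theorem exists_vertex_energy_le {F : Type*} [NormedAddCommGroup F] [InnerProductSpace ℂ F]
    [FiniteDimensional ℂ F] {Y Z : Submodule ℂ F} (T : F →ₗ[ℂ] F) (B : Y →ₗ[ℂ] Z)
    (C : Z →ₗ[ℂ] Z) {Q : Z →ₗ[ℂ] Z} (hQ : ∀ x y : Z, inner ℂ (Q x) y = inner ℂ x (Q y)) {r : ℝ}
    (hr : 0 ≤ r) (h : ∀ ξ : Y, (inner ℂ (ξ : F) (T ξ + (Q (B ξ) : F)
      + (LinearMap.adjoint B (Q (Z.orthogonalProjectionOnto (ξ : F))) : F)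
      - (r : ℂ) • (Q (Z.orthogonalProjectionOnto (ξ : F)) : F))).re ≤ 0) :
    ∃ K, 0 ≤ K ∧ ∀ (ξ : Y) (x : Z), x = Z.orthogonalProjectionOnto (ξ : F) →
      (inner ℂ (ξ : F) (T ξ)).re + 2 * (inner ℂ x (Q (B ξ + C x))).re ≤ K * ‖x‖ ^ 2 := by
  obtain ⟨D, hD, hQD⟩ := exists_re_inner_le_mul_norm_sq Q
  obtain ⟨D', hD', hCD⟩ := exists_re_inner_le_mul_norm_sq (Q ∘ₗ C)
  refine ⟨r * D + 2 * D', by positivity, fun ξ x hx => ?_⟩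
  have h1 := re_inner_add_two_mul_le_of_cone T B hQ hx (by rw [hx]; exact h ξ)
  have h2 : (inner ℂ x (Q (C x))).re ≤ _ := hCD x
  have h3 := mul_le_mul_of_nonneg_left (hQD x) hr
  rw [map_add, inner_add_right, Complex.add_re]
  linarith

end FiniteDimensional

/-! ### Block-diagonal weights on the state space -/

section DirectSum

theorem norm_sq_prod_piLp {ι κ : Type*} [Fintype ι] [Fintype κ] {X : ι → Type*} {Y : κ → Type*}
    [∀ i, NormedAddCommGroup (X i)] [∀ j, NormedAddCommGroup (Y j)]
    (z : WithLp 2 (PiLp 2 X × PiLp 2 Y)) : ‖z‖ ^ 2 = ‖z.fst‖ ^ 2 + ∑ j, ‖z.snd j‖ ^ 2 := by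
  rw [WithLp.prod_norm_sq_eq_of_L2, PiLp.norm_sq_eq_of_L2 Y]

variable {ι κ : Type*} [Fintype ι] [Fintype κ] {X : ι → Type*} {Y : κ → Type*}
  [∀ i, NormedAddCommGroup (X i)] [∀ i, InnerProductSpace ℂ (X i)]
  [∀ j, NormedAddCommGroup (Y j)] [∀ j, InnerProductSpace ℂ (Y j)]

/-- The block-diagonal operator on `(⨁ X i) ⊕ (⨁ Y j)` with the blocks `p i` and `q j`. -/
noncomputable def blockDiagonalMap (p : ∀ i, X i →ₗ[ℂ] X i) (q : ∀ j, Y j →ₗ[ℂ] Y j) :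
    WithLp 2 (PiLp 2 X × PiLp 2 Y) →ₗ[ℂ] WithLp 2 (PiLp 2 X × PiLp 2 Y) where
  toFun z := WithLp.toLp 2 (WithLp.toLp 2 fun i => p i (z.fst i),
    WithLp.toLp 2 fun j => q j (z.snd j))
  map_add' z z' := by
    refine congrArg (WithLp.toLp 2) (Prod.ext ?_ ?_)
    · ext1 i
      exact map_add (p i) _ _
    · ext1 j
      exact map_add (q j) _ _
  map_smul' a z := by
    refine congrArg (WithLp.toLp 2) (Prod.ext ?_ ?_)
    · ext1 i
      exact map_smul (p i) _ _
    · ext1 j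
      exact map_smul (q j) _ _

variable {p : ∀ i, X i →ₗ[ℂ] X i} {q : ∀ j, Y j →ₗ[ℂ] Y j}

theorem inner_blockDiagonalMap (z w : WithLp 2 (PiLp 2 X × PiLp 2 Y)) :
    inner ℂ z (blockDiagonalMap p q w) = ∑ i, inner ℂ (z.fst i) (p i (w.fst i))
      + ∑ j, inner ℂ (z.snd j) (q j (w.snd j)) := by
  rw [WithLp.prod_inner_apply, PiLp.inner_apply, PiLp.inner_apply]
  rfl

theorem isSymmetric_blockDiagonalMap (hp : ∀ i x y, inner ℂ (p i x) y = inner ℂ x (p i y))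
    (hq : ∀ j x y, inner ℂ (q j x) y = inner ℂ x (q j y)) : (blockDiagonalMap p q).IsSymmetric := by
  intro z w
  rw [← inner_conj_symm, inner_blockDiagonalMap, inner_blockDiagonalMap, map_add, map_sum, map_sum]
  congr 1
  · exact Finset.sum_congr rfl fun i _ => by rw [inner_conj_symm, hp]
  · exact Finset.sum_congr rfl fun j _ => by rw [inner_conj_symm, hq]

theorem exists_le_re_inner_blockDiagonalMap
    (hp : ∀ i, ∃ c, 0 < c ∧ ∀ x, c * ‖x‖ ^ 2 ≤ (inner ℂ x (p i x)).re)
    [∀ j, FiniteDimensional ℂ (Y j)] (hq : ∀ j x, x ≠ 0 → 0 < (inner ℂ x (q j x)).re) :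
    ∃ c, 0 < c ∧ ∀ z, c * ‖z‖ ^ 2 ≤ (inner ℂ z (blockDiagonalMap p q z)).re := by
  obtain ⟨c, hc, h⟩ := exists_common_pos
    (fun i x y hxy h u => (by gcongr : x * ‖u‖ ^ 2 ≤ y * ‖u‖ ^ 2).trans (h u)) hp
  obtain ⟨d, hd, h'⟩ := exists_common_pos
    (fun v x y hxy h u => (by gcongr : x * ‖u‖ ^ 2 ≤ y * ‖u‖ ^ 2).trans (h u))
    fun j => exists_pos_mul_norm_sq_le (q j) (hq j)
  refine ⟨min c d, lt_min hc hd, fun z => ?_⟩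
  rw [inner_blockDiagonalMap, norm_sq_prod_piLp, PiLp.norm_sq_eq_of_L2, Complex.add_re,
    Complex.re_sum, Complex.re_sum, mul_add, Finset.mul_sum, Finset.mul_sum]
  refine add_le_add (Finset.sum_le_sum fun i _ => ?_) (Finset.sum_le_sum fun j _ => ?_)
  · exact le_trans (by gcongr; exact min_le_left _ _) (h i _)
  · exact le_trans (by gcongr; exact min_le_right _ _) (h' j _)

/-- The `t j` are the boundary terms, which cancel when the edge inequality and the vertex
inequalities are added. The constant is not sharp. -/
theorem re_inner_blockDiagonalMap_le {z w : WithLp 2 (PiLp 2 X × PiLp 2 Y)} {t : κ → ℝ} {C D : ℝ}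
    (hC : 0 ≤ C) (hD : 0 ≤ D)
    (h : 2 * ∑ i, (inner ℂ (z.fst i) (p i (w.fst i))).re ≤ ∑ j, t j + C * ‖z.fst‖ ^ 2)
    (h' : ∀ j, t j + 2 * (inner ℂ (z.snd j) (q j (w.snd j))).re ≤ D * ‖z.snd j‖ ^ 2) :
    (inner ℂ z (blockDiagonalMap p q w)).re ≤ (C + D) * ‖z‖ ^ 2 := by
  have h1 := Finset.sum_le_sum fun j (_ : j ∈ Finset.univ) => h' j
  rw [Finset.sum_add_distrib, ← Finset.mul_sum, ← Finset.mul_sum] at h1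
  rw [inner_blockDiagonalMap, Complex.add_re, Complex.re_sum, Complex.re_sum, norm_sq_prod_piLp]
  have h2 : 0 ≤ ∑ j, ‖z.snd j‖ ^ 2 := Finset.sum_nonneg fun j _ => by positivity
  have h3 : 0 ≤ ‖z.fst‖ ^ 2 := by positivity
  nlinarith [mul_nonneg hC h2, mul_nonneg hC h3, mul_nonneg hD h2, mul_nonneg hD h3]

end DirectSum

/-! ### The coupled operator: dissipativity, range and generation -/

section CoupledOperator

variable {ι κ : Type*} {X : ι → Type*} {F : κ → Type*}
  [∀ i, NormedAddCommGroup (X i)] [∀ i, InnerProductSpace ℂ (X i)]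
  [∀ j, NormedAddCommGroup (F j)] [∀ j, InnerProductSpace ℂ (F j)]
  [∀ j, FiniteDimensional ℂ (F j)]
  {D : Submodule ℂ (PiLp 2 X)} {Y Z : ∀ j, Submodule ℂ (F j)}

/-- `A` is the operator `(u, x) ↦ (L u, B γ(u) + C x)`, with the domain given by the conditions
`γ(u) ∈ Y` and `x = P γ(u)`, where `P` is the orthogonal projector onto `Z`. -/
def IsCoupledOperator (L : D →ₗ[ℂ] PiLp 2 X) (γ : ∀ j, D →ₗ[ℂ] F j) (B : ∀ j, Y j →ₗ[ℂ] Z j)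
    (C : ∀ j, Z j →ₗ[ℂ] Z j)
    (A : WithLp 2 (PiLp 2 X × PiLp 2 fun j => Z j) →ₗ.[ℂ]
      WithLp 2 (PiLp 2 X × PiLp 2 fun j => Z j)) : Prop :=
  ∀ x y, (x, y) ∈ A.graph ↔ ∃ u : D, x.fst = u ∧ y.fst = L u ∧ ∀ j, ∃ h : γ j u ∈ Y j,
    x.snd j = (Z j).orthogonalProjectionOnto (γ j u) ∧ y.snd j = B j ⟨γ j u, h⟩ + C j (x.snd j)

variable {L : D →ₗ[ℂ] PiLp 2 X} {γ : ∀ j, D →ₗ[ℂ] F j} {B : ∀ j, Y j →ₗ[ℂ] Z j}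
  {C : ∀ j, Z j →ₗ[ℂ] Z j}
  {A : WithLp 2 (PiLp 2 X × PiLp 2 fun j => Z j) →ₗ.[ℂ]
    WithLp 2 (PiLp 2 X × PiLp 2 fun j => Z j)}
  {p : ∀ i, X i →ₗ[ℂ] X i} {Q : ∀ j, Z j →ₗ[ℂ] Z j}

/-- Quasi-dissipativity for the inner product weighted by a symmetrizer. -/
theorem IsCoupledOperator.exists_re_inner_le [Fintype ι] [Fintype κ] (hA : IsCoupledOperator L γ B C A)
    (hp : ∀ i, ∃ c, 0 < c ∧ ∀ x, c * ‖x‖ ^ 2 ≤ (inner ℂ x (p i x)).re)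
    (hQ : ∀ j (x y : Z j), inner ℂ (Q j x) y = inner ℂ x (Q j y))
    (hQ' : ∀ j (x : Z j), x ≠ 0 → 0 < (inner ℂ x (Q j x)).re) (T : ∀ j, F j →ₗ[ℂ] F j)
    (hE : ∃ K, 0 ≤ K ∧ ∀ u : D, 2 * ∑ i, (inner ℂ (u.1 i) (p i (L u i))).re
      ≤ ∑ j, (inner ℂ (γ j u) (T j (γ j u))).re + K * ‖(u : PiLp 2 X)‖ ^ 2)
    (hcone : ∀ j, ∃ r : ℝ, 0 ≤ r ∧ ∀ ξ : Y j, (inner ℂ (ξ : F j) (T j ξ + (Q j (B j ξ) : F j)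
      + (LinearMap.adjoint (B j) (Q j ((Z j).orthogonalProjectionOnto (ξ : F j))) : F j)
      - (r : ℂ) • (Q j ((Z j).orthogonalProjectionOnto (ξ : F j)) : F j))).re ≤ 0) :
    ∃ k : ℝ, ∀ z : A.domain, (inner ℂ z.1 (blockDiagonalMap p Q (A z))).re
      ≤ k * (inner ℂ z.1 (blockDiagonalMap p Q z)).re := by
  obtain ⟨K, hK, hE⟩ := hE
  choose r hr hr' using hcone
  choose D₀ hD₀ hv₀ using fun j =>
    exists_vertex_energy_le (T j) (B j) (C j) (hQ j) (hr j) (hr' j)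
  obtain ⟨q, hq, hpos⟩ := exists_le_re_inner_blockDiagonalMap hp hQ'
  have hD : 0 ≤ ∑ j, D₀ j := Finset.sum_nonneg fun j _ => hD₀ j
  -- Division by the coercivity constant q converts ‖z‖² into the weighted form.
  refine ⟨(K + ∑ j, D₀ j) / q, fun z => ?_⟩
  obtain ⟨u, hu, hu', hj⟩ := (hA z (A z)).1 (A.mem_graph z)
  choose hY hx hy using hj
  have h1 : (inner ℂ z.1 (blockDiagonalMap p Q (A z))).re ≤ (K + ∑ j, D₀ j) * ‖z.1‖ ^ 2 := by
    refine re_inner_blockDiagonalMap_le (t := fun j => (inner ℂ (γ j u) (T j (γ j u))).re) hK hD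
      ?_ fun j => ?_
    · rw [hu, hu']
      exact hE u
    · rw [hy]
      exact (hv₀ j ⟨γ j u, hY j⟩ (z.1.snd j) (hx j)).trans
        (mul_le_mul_of_nonneg_right (Finset.single_le_sum (fun j _ => hD₀ j) (Finset.mem_univ j))
          (sq_nonneg _))
  refine h1.trans ?_
  rw [div_mul_eq_mul_div, le_div_iff₀ hq]
  have h2 := mul_le_mul_of_nonneg_left (hpos z.1) (add_nonneg hK hD)
  linarith

/-- The boundary conditions of the resolvent equation `μ z - A z = 0`. -/
noncomputable def boundaryMap (γ : ∀ j, D →ₗ[ℂ] F j) (B : ∀ j, Y j →ₗ[ℂ] Z j)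
    (C : ∀ j, Z j →ₗ[ℂ] Z j) (μ : ℂ) : D →ₗ[ℂ] ∀ j, (Y j)ᗮ × Z j :=
  LinearMap.pi fun j =>
    ((Y j)ᗮ.orthogonalProjectionOnto.toLinearMap.prod
      (μ • (Z j).orthogonalProjectionOnto.toLinearMap
        - C j ∘ₗ (Z j).orthogonalProjectionOnto.toLinearMap
        - B j ∘ₗ (Y j).orthogonalProjectionOnto.toLinearMap)) ∘ₗ γ j

/-- `boundaryMap` composes B with the projector onto Y so as to be linear on all of D. The vanishing
first component puts γ(u) in Y, where this projector is the identity, and the second component is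
then the second row of μz - Az. -/
theorem IsCoupledOperator.exists_of_boundaryMap_eq (hA : IsCoupledOperator L γ B C A) {μ : ℂ}
    {u : D} {f : PiLp 2 X} {g : PiLp 2 fun j => Z j} (hu : μ • (u : PiLp 2 X) - L u = f)
    (hb : boundaryMap γ B C μ u = fun j => (0, g j)) :
    ∃ z : A.domain, z.1.fst = u ∧ μ • z.1 - A z = WithLp.toLp 2 (f, g) := by
  have h1 : ∀ j, γ j u ∈ Y j := by
    intro j
    have : (Y j)ᗮ.orthogonalProjectionOnto (γ j u) = 0 := congrArg Prod.fst (congrFun hb j)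
    rwa [Submodule.orthogonalProjectionOnto_eq_zero_iff, Submodule.orthogonal_orthogonal] at this
  let x : WithLp 2 (PiLp 2 X × PiLp 2 fun j => Z j) :=
    WithLp.toLp 2 ((u : PiLp 2 X), WithLp.toLp 2 fun j => (Z j).orthogonalProjectionOnto (γ j u))
  let y : WithLp 2 (PiLp 2 X × PiLp 2 fun j => Z j) :=
    WithLp.toLp 2 (L u, WithLp.toLp 2 fun j => B j ⟨γ j u, h1 j⟩ + C j (x.snd j))
  have hxy : (x, y) ∈ A.graph := (hA x y).2 ⟨u, rfl, rfl, fun j => ⟨h1 j, rfl, rfl⟩⟩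
  obtain ⟨z, hz, hz'⟩ := A.mem_graph_iff.1 hxy
  refine ⟨z, congrArg WithLp.fst hz, ?_⟩
  rw [hz, hz']
  refine congrArg (WithLp.toLp 2) (Prod.ext hu ?_)
  ext1 j
  have h2 : μ • (Z j).orthogonalProjectionOnto (γ j u)
      - C j ((Z j).orthogonalProjectionOnto (γ j u))
      - B j ((Y j).orthogonalProjectionOnto (γ j u)) = g j := congrArg Prod.snd (congrFun hb j)
  rw [(Y j).orthogonalProjectionOnto_mem_subspace_eq_self ⟨_, h1 j⟩] at h2
  rw [← h2]
  change μ • (Z j).orthogonalProjectionOnto (γ j u)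
    - (B j ⟨γ j u, h1 j⟩ + C j ((Z j).orthogonalProjectionOnto (γ j u))) = _
  abel

variable {W : Type*} [AddCommGroup W] [Module ℂ W] [FiniteDimensional ℂ W] {ev : D →ₗ[ℂ] W}

/-- The range condition: the number of boundary conditions being right, uniqueness for the
resolvent equation implies existence. -/
theorem IsCoupledOperator.exists_resolvent_eq [Fintype κ] (hA : IsCoupledOperator L γ B C A)
    (hdim : ∑ j, (Module.finrank ℂ (Y j)ᗮ + Module.finrank ℂ (Z j)) = Module.finrank ℂ W) {μ : ℂ}
    (hL : ∀ f a, ∃ u : D, μ • (u : PiLp 2 X) - L u = f ∧ ev u = a)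
    (hinj : ∀ z : A.domain, μ • z.1 - A z = 0 → z = 0)
    (y : WithLp 2 (PiLp 2 X × PiLp 2 fun j => Z j)) : ∃ z : A.domain, μ • z.1 - A z = y := by
  let Λ : D →ₗ[ℂ] PiLp 2 X := μ • D.subtype - L
  have hsurj : LinearMap.range (Λ.prod ev) = ⊤ := by
    rw [LinearMap.range_eq_top]
    rintro ⟨f, a⟩
    obtain ⟨u, hu, ha⟩ := hL f a
    exact ⟨u, Prod.ext hu ha⟩
  -- Solutions of (μ - L)u = f with ev u = a are chosen linearly in (f, a).
  obtain ⟨σ, hσ⟩ := (Λ.prod ev).exists_rightInverse_of_surjective hsurj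
  have hσ1 : ∀ f a, Λ (σ (f, a)) = f := fun f a =>
    congrArg Prod.fst (LinearMap.congr_fun hσ (f, a))
  have hσ2 : ∀ f a, ev (σ (f, a)) = a := fun f a =>
    congrArg Prod.snd (LinearMap.congr_fun hσ (f, a))
  -- From the initial values of a solution of the homogeneous equation to its boundary defects. A
  -- vector in its kernel gives a z with μz = Az, so z = 0 and the initial values vanish.
  let β : W →ₗ[ℂ] ∀ j, (Y j)ᗮ × Z j := boundaryMap γ B C μ ∘ₗ σ ∘ₗ LinearMap.inr ℂ _ _
  have hβi : Function.Injective β := by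
    rw [← LinearMap.ker_eq_bot, LinearMap.ker_eq_bot']
    intro a ha
    obtain ⟨z, hz, hz'⟩ := hA.exists_of_boundaryMap_eq (g := 0) (hσ1 0 a) ha
    have h0 : z = 0 := hinj z hz'
    have h1 : σ (0, a) = 0 := Subtype.ext (hz.symm.trans (by rw [h0]; rfl))
    rw [← hσ2 0 a, h1, map_zero]
  have hβs : Function.Surjective β := by
    refine (LinearMap.injective_iff_surjective_of_finrank_eq_finrank ?_).1 hβi
    rw [Module.finrank_pi_fintype, ← hdim]
    simp only [Module.finrank_prod]
  -- Initial values of the homogeneous solution that corrects the boundary defect of the particular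
  -- solution σ(f, 0).
  obtain ⟨a, ha⟩ := hβs ((fun j => (0, y.snd j)) - boundaryMap γ B C μ (σ (y.fst, 0)))
  obtain ⟨z, -, hz⟩ := hA.exists_of_boundaryMap_eq (g := y.snd) (hσ1 y.fst a) (by
    have h1 : σ (y.fst, a) = σ (y.fst, 0) + σ (0, a) := by
      rw [← map_add]
      simp
    rw [h1, map_add]
    exact eq_sub_iff_add_eq'.1 ha)
  exact ⟨z, hz⟩

theorem IsCoupledOperator.exists_C0Semigroup [Fintype ι] [Fintype κ] [∀ i, CompleteSpace (X i)]
    (hA : IsCoupledOperator L γ B C A) (hp : ∀ i, (p i).IsSymmetric)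
    (hp' : ∀ i, ∃ c, 0 < c ∧ ∀ x, c * ‖x‖ ^ 2 ≤ (inner ℂ x (p i x)).re)
    (hQ : ∀ j (x y : Z j), inner ℂ (Q j x) y = inner ℂ x (Q j y))
    (hQ' : ∀ j (x : Z j), x ≠ 0 → 0 < (inner ℂ x (Q j x)).re) (T : ∀ j, F j →ₗ[ℂ] F j)
    (hE : ∃ K, 0 ≤ K ∧ ∀ u : D, 2 * ∑ i, (inner ℂ (u.1 i) (p i (L u i))).re
      ≤ ∑ j, (inner ℂ (γ j u) (T j (γ j u))).re + K * ‖(u : PiLp 2 X)‖ ^ 2)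
    (hcone : ∀ j, ∃ r : ℝ, 0 ≤ r ∧ ∀ ξ : Y j, (inner ℂ (ξ : F j) (T j ξ + (Q j (B j ξ) : F j)
      + (LinearMap.adjoint (B j) (Q j ((Z j).orthogonalProjectionOnto (ξ : F j))) : F j)
      - (r : ℂ) • (Q j ((Z j).orthogonalProjectionOnto (ξ : F j)) : F j))).re ≤ 0)
    (hdim : ∑ j, (Module.finrank ℂ (Y j)ᗮ + (Module.finrank ℂ (B j).range
      + Module.finrank ℂ (LinearMap.adjoint (B j)).ker)) = Module.finrank ℂ W)
    (hL : ∀ (μ : ℝ) f a, ∃ u : D, (μ : ℂ) • (u : PiLp 2 X) - L u = f ∧ ev u = a) :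
    ∃ S : C0Semigroup (WithLp 2 (PiLp 2 X × PiLp 2 fun j => Z j)), S.IsGeneratedBy A := by
  obtain ⟨q, hq, hpos⟩ := exists_le_re_inner_blockDiagonalMap hp' hQ'
  obtain ⟨k, hk⟩ := hA.exists_re_inner_le hp' hQ hQ' T hE hcone
  have hsym := isSymmetric_blockDiagonalMap hp hQ
  simp only [finrank_range_add_finrank_ker_adjoint] at hdim
  exact exists_C0Semigroup_of_quasiDissipative
    (Q := ⟨blockDiagonalMap p Q, hsym.continuous⟩) hsym hq hpos hk
    fun μ hμ z => hA.exists_resolvent_eq hdim (hL μ)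
      (fun z hz => eq_zero_of_quasiDissipative hq hpos hk hμ hz) z

end CoupledOperator

/-! ### The network operator as a coupled operator -/

namespace Network

namespace VertexConditions

variable {V E : Type*} [Fintype E] {G : Network V E} (b : G.VertexConditions)

theorem isCoupledOperator_blockOperator (c : G.Coefficients) :
    IsCoupledOperator (X := fun e => EdgeL2 (G.length e) (G.dim e))
      (F := fun v => G.VertexSpace v) (D := G.Dmax) (Y := b.Y) (Z := b.Yd)
      c.opA G.trace b.B b.C (b.blockOperator c) := by
  intro x y
  constructor
  · intro h
    obtain ⟨z, rfl, rfl⟩ := (b.blockOperator c).mem_graph_iff.1 h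
    exact ⟨b.domainFst z, rfl, rfl, fun v => ⟨(z.2.choose_spec v).1, (z.2.choose_spec v).2, rfl⟩⟩
  · rintro ⟨u, hx, hy, h⟩
    have hxm : x.fst ∈ G.Dmax := hx ▸ u.2
    have hu : u = ⟨x.fst, hxm⟩ := Subtype.ext hx.symm
    subst hu
    refine (b.blockOperator c).mem_graph_iff.2
      ⟨⟨x, hxm, fun v => ⟨(h v).choose, (h v).choose_spec.1⟩⟩, rfl, ?_⟩
    have h2 : (WithLp.equiv 2 _ y).2 = WithLp.toLp 2 fun v =>
        b.B v ⟨G.trace v ⟨x.fst, hxm⟩, (h v).choose⟩ + b.C v (x.snd v) := by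
      ext1 v
      exact (h v).choose_spec.2
    exact (congrArg (WithLp.toLp 2) (Prod.ext hy h2)).symm

open Module in
-- Both sides count k: the left is the cardinality of the given basis of ℂ^k, the right is the
-- number of initial values.
theorem sum_finrank_eq [Fintype V]
    (w : ∀ v, Basis (Fin (finrank ℂ (b.Y v)ᗮ)) ℂ (b.Y v)ᗮ)
    (y : ∀ v, Basis (Fin (finrank ℂ (b.B v).range)) ℂ (b.B v).range)
    (wK : ∀ v, Basis (Fin (finrank ℂ (b.Bstar v).ker)) ℂ (b.Bstar v).ker)
    (hbasis : LinearIndependent ℂ (b.extendedVectors w y wK) ∧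
      Submodule.span ℂ (Set.range (b.extendedVectors w y wK)) = ⊤) :
    ∑ v, (finrank ℂ (b.Y v)ᗮ + (finrank ℂ (b.B v).range + finrank ℂ (b.Bstar v).ker))
      = finrank ℂ (∀ e, EuclideanSpace ℂ (Fin (G.dim e))) := by
  have h1 := finrank_eq_card_basis (Basis.mk hbasis.1 hbasis.2.ge)
  rw [finrank_euclideanSpace, Fintype.card_sigma, Fintype.card_sigma] at h1
  simp only [Fintype.card_fin, Fintype.card_sum] at h1
  rw [finrank_pi_fintype]
  simp only [finrank_euclideanSpace, Fintype.card_fin]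
  exact h1.symm

end VertexConditions

end Network

theorem mainTheorem1 {V E : Type*} [Fintype V] [Fintype E] (G : Network V E)
    (c : G.Coefficients) (b : G.VertexConditions)
    (w : ∀ v, Module.Basis (Fin (Module.finrank ℂ (b.Y v)ᗮ)) ℂ (b.Y v)ᗮ)
    (y : ∀ v, Module.Basis (Fin (Module.finrank ℂ (b.B v).range)) ℂ (b.B v).range)
    (wK : ∀ v, Module.Basis (Fin (Module.finrank ℂ (b.Bstar v).ker)) ℂ (b.Bstar v).ker)
    (hbasis : LinearIndependent ℂ (b.extendedVectors w y wK) ∧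
      Submodule.span ℂ (Set.range (b.extendedVectors w y wK)) = ⊤)
    (hcone : ∀ v, ∃ r : ℝ, 0 ≤ r ∧ b.InNonposCone c r v) :
    ∃ S : C0Semigroup b.StateSpace, S.IsGeneratedBy (b.blockOperator c) :=
  IsCoupledOperator.exists_C0Semigroup (X := fun e => EdgeL2 (G.length e) (G.dim e))
    (F := fun v => G.VertexSpace v) (D := G.Dmax) (Y := b.Y) (Z := b.Yd)
    (L := c.opA) (γ := G.trace) (B := b.B) (C := b.C) (A := b.blockOperator c)
    (p := c.symmetrizer) (Q := b.Q) (W := ∀ e, EuclideanSpace ℂ (Fin (G.dim e)))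
    -- The free parameters of the resolvent equation are the values of u_e at the initial endpoints,
    -- k scalars in all.
    (ev := LinearMap.pi fun e =>
      pointValue (G.length_pos e) ⟨0, left_mem_Icc.2 (G.length_pos e).le⟩ ∘ₗ G.edgePart e)
    (b.isCoupledOperator_blockOperator c) c.isSymmetric_symmetrizer
    c.exists_le_re_inner_symmetrizer b.Q_symmetric b.Q_pos c.T c.exists_energy_le hcone
    (b.sum_finrank_eq w y wK hbasis) fun μ f a => by
      obtain ⟨u, hu, ha⟩ := c.exists_opA_eq μ f a
      exact ⟨u, hu, funext ha⟩
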